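/- Let $V$ be a finite-dimensional complex vector space with a rational structure $V_{\mathbb Q}$, $W$ a finite increasing filtration of $V$ defined over $\mathbb Q$, and $\mathcal S_k$ rational non-degenerate bilinear forms of parity $(-1)^k$ on $Gr^W_k$. Let $\mathfrak g=Lie(G_{\mathbb C})$ be the Lie algebra of all endomorphisms of $V$ that preserve $W$ and induce infinitesimal isometries of the forms $\mathcal S_k$. Let $(F_\infty,M)$ be a mixed Hodge structure on $(V,V_{\mathbb Q})$ with Deligne bigrading $V=\bigoplus_{p,q} I^{p,q}$, and let $N_1,\dots,N_n\in\mathfrak g$ be commuting rational endomorphisms with $N_jF^p_\infty\subseteq F^{p-1}_\infty$ and $N_jM_k\subseteq M_{k-2}$ (for instance, the limiting mixed Hodge structure and the monodromy logarithms of an admissible variation of graded-polarized mixed Hodge structure over $\Delta^{*n}$ with unipotent monodromy, $M$ being the relative weight filtration). Put $$U^p=\bigoplus_q I^{p,q},\qquad \wp_a=\{\alpha\in\mathfrak g \mid \alpha(U^p)\subseteq U^{p+a}\ \ \forall p\},\qquad q_\infty=\bigoplus_{a<0}\wp_a,$$ and write $\alpha_a$ for the $\wp_a$-component of $\alpha\in\bigoplus_b\wp_b$.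 Let $r>0$, $\Delta^n_r=\{s\in\mathbb C^n \mid |s_j|<r\ \ \forall j\}$, $\Delta^{*n}_r=\{s\in\Delta^n_r \mid s_1\cdots s_n\ne0\}$, and $\Omega=\frac1{2\pi i}\sum_j\frac{ds_j}{s_j}\otimes N_j$. A solution is a holomorphic function $\Gamma:\Delta^n_r\to q_\infty$ with $\Gamma(0)=0$ such that $$e^{-ad\,\Gamma}\,\Omega+e^{-\Gamma}\,\partial e^{\Gamma}\in\wp_{-1}\quad\text{on }\Delta^{*n}_r. \qquad (6.10)$$ Then $\Gamma\mapsto\Gamma_{-1}$ is a bijection from the set of solutions onto the set of holomorphic functions $\Gamma_{-1}:\Delta^n_r\to\wp_{-1}$ which satisfy $\Gamma_{-1}(0)=0$ and $\partial X_{-1}\wedge\partial X_{-1}=0$ on $\Delta^{*n}_r$, where $\partial X_{-1}=\Omega+\partial\Gamma_{-1}$. Moreover, for every solution $\Gamma$: (a) The higher components are determined inductively: for each $k\ge2$, $\Gamma_{-k}$ is the unique holomorphic function $\Delta^n_r\to\wp_{-k}$ that vanishes at $0$ and satisfies on $\Delta^{*n}_r$ $$\partial\Gamma_{-k}=-\left(e^{-ad\,G}\,\Omega+e^{-G}\,\partial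 e^{G}\right)_{-k},\qquad G=\Gamma_{-1}+\dots+\Gamma_{-(k-1)}.$$ (b) The connection $d+\partial X_{-1}$ on the product bundle $V\times\Delta^{*n}_r$ is flat, and its monodromy about the loop $\gamma_j(t)=(s_1,\dots,e^{2\pi it}s_j,\dots,s_n)$, $0\le t\le1$, is $T_j=e^{-\Gamma}e^{-N_j}e^{\Gamma}$ (all evaluated at the base point $s\in\Delta^{*n}_r$). -/

import Mathlib

namespace LimitHodge

noncomputable section

section LinearAlgebra

variable {V : Type*} [NormedAddCommGroup V] [NormedSpace ℂ V]

/-- A rational structure on a complex vector space `V`: a rational subspace `VQ` with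
`V = VQ ⊗ ℂ`, together with the induced complex conjugation of `V`, i.e. the (unique) conjugate
linear map that fixes `VQ` pointwise. -/
structure RationalStructure (V : Type*) [NormedAddCommGroup V] [NormedSpace ℂ V]
    [Module ℚ V] where
  VQ : Submodule ℚ V
  isBaseChange : IsBaseChange ℂ VQ.subtype
  conj : V →ₛₗ[starRingEnd ℂ] V
  conj_eq_self : ∀ v ∈ VQ, conj v = v

/-- The complex conjugate of a subspace (conjugation is an involution, so that image and preimage
agree). -/
def RationalStructure.conjSubspace [Module ℚ V] (R : RationalStructure V) (U : Submodule ℂ V) :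
    Submodule ℂ V :=
  U.comap R.conj

/-- A complex subspace is defined over `ℚ` if it is spanned by its rational vectors. -/
def RationalStructure.IsRational [Module ℚ V] (R : RationalStructure V) (U : Submodule ℂ V) :
    Prop :=
  Submodule.span ℂ {v : V | v ∈ U ∧ v ∈ R.VQ} = U

/-- The graded quotient `Gr_k = W_k / W_{k-1}`. -/
abbrev Gr (W : ℤ → Submodule ℂ V) (k : ℤ) : Type _ :=
  ↥(W k) ⧸ (W (k - 1)).submoduleOf (W k)

/-- The class in `Gr_k` of an element of `W_k`. -/
def toGr (W : ℤ → Submodule ℂ V) (k : ℤ) : ↥(W k) →ₗ[ℂ] Gr W k :=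
  ((W (k - 1)).submoduleOf (W k)).mkQ

/-- The endomorphism of `Gr_k` induced by an endomorphism that preserves `W`. -/
def grMap (W : ℤ → Submodule ℂ V) (α : V →L[ℂ] V) (h : ∀ k, ∀ v ∈ W k, α v ∈ W k) (k : ℤ) :
    Gr W k →ₗ[ℂ] Gr W k :=
  Submodule.mapQ _ _ ((α : V →ₗ[ℂ] V).restrict (h k)) (fun x hx => h (k - 1) x.1 hx)

/-- The image of a subspace `U` in `Gr_k`, i.e. `(U ∩ W_k + W_{k-1}) / W_{k-1}`. -/
def inducedGr (W : ℤ → Submodule ℂ V) (U : Submodule ℂ V) (k : ℤ) : Submodule ℂ (Gr W k) :=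
  (U.submoduleOf (W k)).map (toGr W k)

/-- `W` is a finite increasing filtration of `V`. -/
structure IsIncFiltration (W : ℤ → Submodule ℂ V) : Prop where
  mono : Monotone W
  bot : ∃ k, W k = ⊥
  top : ∃ k, W k = ⊤

/-- `F` is a finite decreasing filtration of `V`. -/
structure IsDecFiltration (F : ℤ → Submodule ℂ V) : Prop where
  anti : Antitone F
  bot : ∃ p, F p = ⊥
  top : ∃ p, F p = ⊤

/-- `(F, M)` is a mixed Hodge structure on `V`: the weight filtration `M` is defined over `ℚ`, and
for each `k` the filtration induced by `F` on `Gr^M_k` is a pure Hodge structure of weight `k`,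
that is, `Gr^M_k = F^p Gr ⊕ conj (F^{k+1-p} Gr)` for all `p`.
(As `M` is defined over `ℚ`, the conjugate of the filtration induced by `F` is the filtration
induced by the conjugate of `F`.) -/
structure IsMixedHodgeStructure [Module ℚ V] (R : RationalStructure V)
    (F M : ℤ → Submodule ℂ V) : Prop where
  dec : IsDecFiltration F
  inc : IsIncFiltration M
  rational : ∀ k, R.IsRational (M k)
  pure : ∀ k p : ℤ,
    IsCompl (inducedGr M (F p) k) (inducedGr M (R.conjSubspace (F (k + 1 - p))) k)

/-- The Deligne bigrading `I^{p,q}` of a mixed Hodge structure `(F, M)`, by Deligne's formula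
`I^{p,q} = F^p ∩ M_{p+q} ∩ (conj F^q ∩ M_{p+q} + ∑_{i ≥ 1} conj F^{q-i} ∩ M_{p+q-i-1})`.
It is the unique bigrading `V = ⨁ I^{p,q}` with `F^p = ⨁_{r ≥ p, s} I^{r,s}`,
`M_k = ⨁_{r+s ≤ k} I^{r,s}` and `I^{p,q} = conj I^{q,p}` modulo `⨁_{r<p, s<q} I^{r,s}`. -/
def deligneI [Module ℚ V] (R : RationalStructure V) (F M : ℤ → Submodule ℂ V) (p q : ℤ) :
    Submodule ℂ V :=
  F p ⊓ M (p + q) ⊓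
    ((R.conjSubspace (F q) ⊓ M (p + q)) ⊔
      ⨆ i : ℕ, R.conjSubspace (F (q - (i + 1))) ⊓ M (p + q - (i + 1) - 1))

/-- The subspaces `U^p = ⨁_q I^{p,q}`. -/
def hodgeU [Module ℚ V] (R : RationalStructure V) (F M : ℤ → Submodule ℂ V) (p : ℤ) :
    Submodule ℂ V :=
  ⨆ q, deligneI R F M p q

/-- The Lie algebra of the complex group of all automorphisms of `V` that preserve the filtration
`W` and induce isometries of the bilinear forms `S_k` on `Gr^W_k`: the endomorphisms that preserve
`W` and induce infinitesimal isometries of all the forms `S_k`. -/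
def lieG (W : ℤ → Submodule ℂ V) (S : ∀ k, LinearMap.BilinForm ℂ (Gr W k)) :
    Submodule ℂ (V →L[ℂ] V) where
  carrier := {α | ∃ h : ∀ k, ∀ v ∈ W k, α v ∈ W k,
    ∀ k x y, S k (grMap W α h k x) y + S k x (grMap W α h k y) = 0}
  zero_mem' := by
    refine ⟨fun k v _ => by simp, fun k x y => ?_⟩
    obtain ⟨x, rfl⟩ := Submodule.Quotient.mk_surjective _ x
    obtain ⟨y, rfl⟩ := Submodule.Quotient.mk_surjective _ y
    have e : ∀ (h : ∀ k, ∀ v ∈ W k, (0 : V →L[ℂ] V) v ∈ W k) (z : W k),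
        grMap W 0 h k (Submodule.Quotient.mk z) = 0 := fun h z =>
      (Submodule.Quotient.mk_eq_zero _).2 (Submodule.zero_mem _)
    simp [e]
  add_mem' := by
    rintro α β ⟨ha, hα⟩ ⟨hb, hβ⟩
    refine ⟨fun k v hv => (W k).add_mem (ha k v hv) (hb k v hv), fun k x y => ?_⟩
    have e : ∀ (h : ∀ k, ∀ v ∈ W k, (α + β) v ∈ W k) (z : Gr W k),
        grMap W (α + β) h k z = grMap W α ha k z + grMap W β hb k z := fun h z => by
      obtain ⟨z, rfl⟩ := Submodule.Quotient.mk_surjective _ z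
      rfl
    have h1 := hα k x y
    have h2 := hβ k x y
    simp only [e, map_add, LinearMap.add_apply]
    linear_combination h1 + h2
  smul_mem' := by
    rintro c α ⟨ha, hα⟩
    refine ⟨fun k v hv => (W k).smul_mem c (ha k v hv), fun k x y => ?_⟩
    have e : ∀ (h : ∀ k, ∀ v ∈ W k, (c • α) v ∈ W k) (z : Gr W k),
        grMap W (c • α) h k z = c • grMap W α ha k z := fun h z => by
      obtain ⟨z, rfl⟩ := Submodule.Quotient.mk_surjective _ z
      rfl
    have h1 := hα k x y
    simp only [e, map_smul, LinearMap.smul_apply, smul_eq_mul]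
    linear_combination c * h1

end LinearAlgebra

/-- The linear algebra data at the origin of an admissible variation of graded-polarized mixed
Hodge structure over `Δ*^n`:
* a rational structure on `V`, a weight filtration `W` defined over `ℚ`, and rational,
  non-degenerate bilinear forms `S_k` on `Gr^W_k` of parity `(-1)^k`;
* a mixed Hodge structure `(F, M)` on `V`, the limiting mixed Hodge structure;
* commuting rational endomorphisms `N_1, …, N_n`, the monodromy logarithms, which belong to the
  Lie algebra attached to `(W, S)` and are `(-1,-1)`-morphisms of `(F, M)`.
For an admissible variation, `M` is the relative weight filtration of `W` and the monodromy cone;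
no more than the above is required of it here. -/
structure LimitData (V : Type*) [NormedAddCommGroup V] [NormedSpace ℂ V] [Module ℚ V]
    (n : ℕ) where
  R : RationalStructure V
  W : ℤ → Submodule ℂ V
  W_filtration : IsIncFiltration W
  W_rational : ∀ k, R.IsRational (W k)
  S : ∀ k, LinearMap.BilinForm ℂ (Gr W k)
  S_nondegenerate : ∀ k, (S k).Nondegenerate
  S_parity : ∀ k x y, S k y x = (k.negOnePow : ℤ) • S k x y
  S_rational : ∀ k (x y : W k), (x : V) ∈ R.VQ → (y : V) ∈ R.VQ →
    ∃ c : ℚ, S k (toGr W k x) (toGr W k y) = (c : ℂ)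
  F : ℤ → Submodule ℂ V
  M : ℤ → Submodule ℂ V
  isMixedHodgeStructure : IsMixedHodgeStructure R F M
  N : Fin n → (V →L[ℂ] V)
  N_comm : ∀ i j, N i * N j = N j * N i
  N_mem : ∀ j, N j ∈ lieG W S
  N_rational : ∀ j, ∀ v ∈ R.VQ, N j v ∈ R.VQ
  N_F : ∀ j p, ∀ v ∈ F p, N j v ∈ F (p - 1)
  N_M : ∀ j k, ∀ v ∈ M k, N j v ∈ M (k - 2)

/-- The polydisk of radius `r` in `ℂ^n`. -/
def polydisk (n : ℕ) (r : ℝ) : Set (Fin n → ℂ) := {s | ∀ j, ‖s j‖ < r}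

/-- The complement of the coordinate hyperplanes in the polydisk of radius `r`. -/
def puncturedPolydisk (n : ℕ) (r : ℝ) : Set (Fin n → ℂ) :=
  {s | s ∈ polydisk n r ∧ ∀ j, s j ≠ 0}

/-- Extension by zero of a function on the polydisk. As the polydisk is open, the values of the
extension outside of it play no role in what follows. -/
def ext {n : ℕ} {r : ℝ} {E : Type*} [Zero E] (f : polydisk n r → E) : (Fin n → ℂ) → E :=
  Function.extend Subtype.val f 0

/-- Holomorphic functions on the polydisk. -/
def IsHolomorphic {n : ℕ} {r : ℝ} {E : Type*} [NormedAddCommGroup E] [NormedSpace ℂ E]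
    (f : polydisk n r → E) : Prop :=
  DifferentiableOn ℂ (ext f) (polydisk n r)

/-- The partial derivative `∂f/∂s_j`. -/
def pderiv {n : ℕ} {E : Type*} [NormedAddCommGroup E] [NormedSpace ℂ E]
    (j : Fin n) (f : (Fin n → ℂ) → E) (s : Fin n → ℂ) : E :=
  fderiv ℂ f s (Pi.single j 1)

section Equation

variable {V : Type*} [NormedAddCommGroup V] [NormedSpace ℂ V] [Module ℚ V] {n : ℕ}

/-- `ad x = [x, ·]` as an operator on the endomorphisms of `V`. -/
def adOp (x : V →L[ℂ] V) : (V →L[ℂ] V) →L[ℂ] (V →L[ℂ] V) :=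
  ContinuousLinearMap.mul ℂ (V →L[ℂ] V) x - (ContinuousLinearMap.mul ℂ (V →L[ℂ] V)).flip x

/-- The exponential in a normed ring (`NormedSpace.exp`). -/
def ringExp {A : Type*} [NormedRing A] (x : A) : A := NormedSpace.exp x

/-- `e^{-ad x} y`, where `e^{-ad x}` is the exponential of an operator on the endomorphisms of
`V`. -/
def expNegAd (x y : V →L[ℂ] V) : V →L[ℂ] V := ringExp (-(adOp x)) y

namespace LimitData

variable (D : LimitData V n)

/-- The Lie algebra of the group attached to `(W, S)`. -/
def lieAlg : Submodule ℂ (V →L[ℂ] V) := lieG D.W D.S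

/-- The subspaces `U^p` of the limiting mixed Hodge structure. -/
def U (p : ℤ) : Submodule ℂ V := hodgeU D.R D.F D.M p

/-- `℘_a`: the elements of the Lie algebra that map `U^p` to `U^{p+a}` for all `p`. -/
def wp (a : ℤ) : Submodule ℂ (V →L[ℂ] V) where
  carrier := {α | α ∈ D.lieAlg ∧ ∀ p, ∀ u ∈ D.U p, α u ∈ D.U (p + a)}
  zero_mem' := ⟨Submodule.zero_mem _, fun p u _ => by simp⟩
  add_mem' := fun {α β} hα hβ => ⟨Submodule.add_mem _ hα.1 hβ.1,
    fun p u hu => (D.U (p + a)).add_mem (hα.2 p u hu) (hβ.2 p u hu)⟩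
  smul_mem' := fun c {α} hα => ⟨Submodule.smul_mem _ c hα.1,
    fun p u hu => (D.U (p + a)).smul_mem c (hα.2 p u hu)⟩

/-- The graded nilpotent Lie algebra `q = ⨁_{a<0} ℘_a`. -/
def qInf : Submodule ℂ (V →L[ℂ] V) := ⨆ a : ℤ, ⨆ _ : a < 0, D.wp a

/-- The component `α_a ∈ ℘_a` of an element `α = ∑_b α_b` of `⨁_b ℘_b`. -/
def component (a : ℤ) (α : V →L[ℂ] V) : V →L[ℂ] V :=
  (Classical.epsilon fun β : ℤ →₀ (V →L[ℂ] V) =>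
    (∀ b, β b ∈ D.wp b) ∧ (β.sum fun _ x => x) = α) a

/-- The coefficient of `ds_j` in `Ω = (1 / 2πi) ∑_j (ds_j / s_j) ⊗ N_j`. -/
def omega (j : Fin n) (s : Fin n → ℂ) : V →L[ℂ] V :=
  (1 / (2 * Real.pi * Complex.I) * (1 / s j)) • D.N j

/-- The coefficient of `ds_j` in `e^{-ad Γ} Ω + e^{-Γ} ∂e^Γ`. -/
def form (Γ : (Fin n → ℂ) → (V →L[ℂ] V)) (j : Fin n) (s : Fin n → ℂ) : V →L[ℂ] V :=
  expNegAd (Γ s) (D.omega j s) +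
    NormedSpace.exp (-(Γ s)) * pderiv j (fun u => NormedSpace.exp (Γ u)) s

/-- Solutions of the differential equation: holomorphic functions `Γ` from the polydisk to `q`,
vanishing at the origin, such that `e^{-ad Γ} Ω + e^{-Γ} ∂e^Γ ∈ ℘_{-1}` on the complement of the
coordinate hyperplanes. -/
def IsSolution {r : ℝ} (Γ : polydisk n r → (V →L[ℂ] V)) : Prop :=
  IsHolomorphic Γ ∧ (∀ s, Γ s ∈ D.qInf) ∧ ext Γ 0 = 0 ∧
    ∀ s ∈ puncturedPolydisk n r, ∀ j, D.form (ext Γ) j s ∈ D.wp (-1)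

/-- The coefficient of `ds_j` in `∂X_{-1} = Ω + ∂Γ_{-1}`, where `g = Γ_{-1}`. -/
def higgs {r : ℝ} (g : polydisk n r → (V →L[ℂ] V)) (j : Fin n) (s : Fin n → ℂ) : V →L[ℂ] V :=
  D.omega j s + pderiv j (ext g) s

/-- Holomorphic functions `g = Γ_{-1}` from the polydisk to `℘_{-1}`, vanishing at the origin, with
`∂X_{-1} ∧ ∂X_{-1} = 0` on the complement of the coordinate hyperplanes. -/
def IsHiggsMap {r : ℝ} (g : polydisk n r → (V →L[ℂ] V)) : Prop :=
  IsHolomorphic g ∧ (∀ s, g s ∈ D.wp (-1)) ∧ ext g 0 = 0 ∧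
    ∀ s ∈ puncturedPolydisk n r, ∀ i j,
      D.higgs g i s * D.higgs g j s - D.higgs g j s * D.higgs g i s = 0

/-- The component `Γ_a` of a function `Γ` on the polydisk. -/
def componentMap {r : ℝ} (a : ℤ) (Γ : polydisk n r → (V →L[ℂ] V)) :
    polydisk n r → (V →L[ℂ] V) :=
  fun s => D.component a (Γ s)

/-- The truncation `Γ_{-1} + ⋯ + Γ_{-(k-1)}` of a function `Γ` on the polydisk. -/
def truncation {r : ℝ} (k : ℕ) (Γ : polydisk n r → (V →L[ℂ] V)) :
    polydisk n r → (V →L[ℂ] V) :=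
  fun s => ∑ i ∈ Finset.Ico 1 k, D.component (-(i : ℤ)) (Γ s)

/-- The curvature of the connection `d + ∂X_{-1}` on the trivial bundle with fibre `V` vanishes on
the complement of the coordinate hyperplanes. -/
def IsFlat {r : ℝ} (g : polydisk n r → (V →L[ℂ] V)) : Prop :=
  ∀ s ∈ puncturedPolydisk n r, ∀ i j,
    pderiv i (D.higgs g j) s - pderiv j (D.higgs g i) s
      + (D.higgs g i s * D.higgs g j s - D.higgs g j s * D.higgs g i s) = 0

/-- The loop `γ_j(t) = (s_1, …, e^{2πit} s_j, …, s_n)`, `0 ≤ t ≤ 1`. -/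
def loop (j : Fin n) (s : Fin n → ℂ) (t : ℝ) : Fin n → ℂ :=
  Function.update s j (Complex.exp (2 * Real.pi * Complex.I * t) * s j)

/-- `T` is the monodromy of the connection `d + ∂X_{-1}` along the loop `γ_j` at `s`: parallel
translation of `v` along the loop, i.e. solving `σ' + ∂X_{-1}(γ_j') σ = 0` with `σ(0) = v`, ends at
`σ(1) = T v`. -/
def IsMonodromy {r : ℝ} (g : polydisk n r → (V →L[ℂ] V)) (j : Fin n) (s : Fin n → ℂ)
    (T : V →L[ℂ] V) : Prop :=
  ∀ v : V, ∃ σ : ℝ → V, σ 0 = v ∧ σ 1 = T v ∧ ∀ t ∈ Set.Icc (0 : ℝ) 1,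
    HasDerivWithinAt σ
      (-((2 * Real.pi * Complex.I * loop j s t j) • D.higgs g j (loop j s t) (σ t)))
      (Set.Icc 0 1) t

end LimitData

end Equation

end

end LimitHodge

/-! Multiplying the coefficient of `ds_j` by `s_j` replaces `∂/∂s_j` by the Euler derivation `θ_j =
s_j ∂/∂s_j` and `Ω` by its constant residues `M_j = N_j/2πi`. With `u = e^Γ`, the form in (6.10)
becomes `e^{-Γ}(θ_j + M_j)e^Γ` (`logForm`). Deligne's bigrading makes `V` the direct sum of the
`U^p`, hence grades `End V` with only finitely many nonzero degrees; each `N_j` is real and shifts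
both filtrations, so it has degree -1.

Modulo degrees below -1 the form is `M_j + θ_jΓ_{-1}`. Thus (6.10) says exactly that `θ_j u + M_j u
= u h_j`, where `h_j = M_j + θ_jΓ_{-1}` (`Intertwines`, `logForm_eq_higgsForm`). The `M_j` commute,
`∑ h_j ds_j/s_j` is closed and `u` is invertible, so `θ_iθ_j u = θ_jθ_i u` forces the `h_j` to
commute (`commute_of_intertwines`). This is the Higgs condition.

In degree -k with `k ≥ 2`, (6.10) expresses `θ_jΓ_{-k}` through the lower truncation of `Γ`
(`eulerDeriv_proj_eq`). A holomorphic function on the polydisk is determined by its Euler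
derivatives and its value at 0, which gives injectivity and (a).

For surjectivity, the linear equation for `u` is solved one degree at a time: `θ_j u_{k+1} = u_k h_j
- M_j u_k`. The right side is closed because the `h_j` commute, vanishes at 0, and is integrated by
a logarithmic Poincaré lemma (`exists_log_primitive`, `exists_intertwines`). The series stops by
nilpotency. A logarithm of `u` is again built degree by degree, and it stays in the Lie algebra
because its Euler derivatives do (`exists_solution`).

For (b), `e^Γ` is a gauge transformation from `d + ∂X_{-1}` to `d + Ω`. It is single valued on the
whole polydisk, so the monodromy is conjugate to `e^{-N_j}` (`parallelTransport_iff`). -/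

namespace LimitHodge

/-! ### Opposite filtrations and Deligne's splitting -/

section OppositeFiltrations

variable {E : Type*} [AddCommGroup E] [Module ℂ E] {F A : ℤ → Submodule ℂ E}

/-- Summands of index below `p` lie in `A p`, those above in `F (p + 1)`. If `x = f + a`
accordingly, then `a` lies in `F p ∩ A p = 0`, and then `f` lies in `F (p + 1) ∩ A (p + 1) = 0`. -/
theorem iSupIndep_inf_of_opposite (hF : Antitone F) (hA : Monotone A)
    (h : ∀ p, Disjoint (F p) (A p)) : iSupIndep fun p => F p ⊓ A (p + 1) := by
  intro p
  have hle : (⨆ j, ⨆ (_ : j ≠ p), F j ⊓ A (j + 1)) ≤ F (p + 1) ⊔ A p := by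
    refine iSup₂_le fun j hj => ?_
    rcases lt_or_gt_of_ne hj with hj | hj
    · exact (inf_le_right.trans (hA (by omega))).trans le_sup_right
    · exact (inf_le_left.trans (hF (by omega))).trans le_sup_left
  refine Disjoint.mono_right hle ?_
  rw [Submodule.disjoint_def]
  rintro x ⟨hx1, hx2⟩ hx
  obtain ⟨f, hf, a, ha, rfl⟩ := Submodule.mem_sup.1 hx
  have hf' : f ∈ F p := hF (by omega) hf
  have ha0 : a = 0 := by
    refine (Submodule.disjoint_def.1 (h p)) a ?_ ha
    have := (F p).sub_mem hx1 hf'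
    simpa using this
  subst ha0
  rw [add_zero] at hx2 ⊢
  exact (Submodule.disjoint_def.1 (h (p + 1))) f hf hx2

/-- Descending induction from the index where `F` vanishes: for `x ∈ F p` split as `f + a` along `F
(p + 1)` and `A (p + 1)`, the part `a = x - f` again lies in `F p`, hence in the summand of index
`p`. -/
theorem iSup_inf_eq_top_of_opposite (hF : Antitone F) (h : ∀ p, IsCompl (F p) (A p))
    (hbot : ∃ p, F p = ⊥) (htop : ∃ p, F p = ⊤) : ⨆ p, F p ⊓ A (p + 1) = ⊤ := by
  obtain ⟨b, hb⟩ := hbot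
  obtain ⟨t, ht⟩ := htop
  have key : ∀ m : ℕ, F (b - m) ≤ ⨆ p, F p ⊓ A (p + 1) := by
    intro m
    induction m with
    | zero => simp [hb]
    | succ m ih =>
      intro x hx
      have e : b - ((m + 1 : ℕ) : ℤ) + 1 = b - m := by push_cast; ring
      have hx' : x ∈ F (b - m) ⊔ A (b - m) := by rw [(h (b - m)).sup_eq_top]; trivial
      obtain ⟨f, hf, a, ha, rfl⟩ := Submodule.mem_sup.1 hx'
      refine Submodule.add_mem _ (ih hf) ?_
      refine Submodule.mem_iSup_of_mem (b - ((m + 1 : ℕ) : ℤ)) ⟨?_, by rwa [e]⟩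
      have := Submodule.sub_mem _ hx (hF (by push_cast; omega : b - ((m + 1 : ℕ) : ℤ) ≤ b - m) hf)
      simpa using this
  rw [eq_top_iff, ← ht]
  exact (hF (by omega : b - (b - t).toNat ≤ t)).trans (key _)

end OppositeFiltrations

section DeligneSplitting

variable {V : Type*} [NormedAddCommGroup V] [NormedSpace ℂ V] {F G M : ℤ → Submodule ℂ V}

theorem mem_inducedGr {W : ℤ → Submodule ℂ V} {U : Submodule ℂ V} {k : ℤ} {c : Gr W k} :
    c ∈ inducedGr W U k ↔ ∃ x : W k, (x : V) ∈ U ∧ toGr W k x = c :=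
  Iff.rfl

theorem toGr_surjective (W : ℤ → Submodule ℂ V) (k : ℤ) : Function.Surjective (toGr W k) :=
  Submodule.mkQ_surjective _

theorem toGr_eq_iff {W : ℤ → Submodule ℂ V} {k : ℤ} {x y : W k} :
    toGr W k x = toGr W k y ↔ (x : V) - y ∈ W (k - 1) := by
  simp only [toGr, Submodule.mkQ_apply, Submodule.Quotient.eq]
  rfl

/-- The pieces `(G^{j+1-p} ∩ M_j)_{j ≤ m}` together. -/
def oppositePart (G M : ℤ → Submodule ℂ V) (m p : ℤ) : Submodule ℂ V :=
  ⨆ j, ⨆ (_ : j ≤ m), G (j + 1 - p) ⊓ M j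

theorem inf_le_oppositePart {m p j : ℤ} (hj : j ≤ m) :
    G (j + 1 - p) ⊓ M j ≤ oppositePart G M m p :=
  le_iSup₂_of_le j hj le_rfl

theorem oppositePart_le (hM : Monotone M) (m p : ℤ) : oppositePart G M m p ≤ M m :=
  iSup₂_le fun _ hj => inf_le_right.trans (hM hj)

theorem oppositePart_mono (hG : Antitone G) (m : ℤ) : Monotone (oppositePart G M m) :=
  fun _ _ hp => iSup₂_mono fun _ _ => inf_le_inf_right _ (hG (by omega))

theorem mem_oppositePart_iff {m p : ℤ} {x : V} : x ∈ oppositePart G M m p ↔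
    ∃ g ∈ G (m + 1 - p) ⊓ M m, ∃ a ∈ oppositePart G M (m - 1) p, g + a = x := by
  have : oppositePart G M m p = (G (m + 1 - p) ⊓ M m) ⊔ oppositePart G M (m - 1) p := by
    refine le_antisymm (iSup₂_le fun j hj => ?_) (sup_le (inf_le_oppositePart le_rfl) ?_)
    · rcases hj.eq_or_lt with rfl | hj
      · exact le_sup_left
      · exact (inf_le_oppositePart (by omega)).trans le_sup_right
    · exact iSup₂_le fun j hj => inf_le_oppositePart (by omega)
  rw [this, Submodule.mem_sup]

/-- On each `M_m` the filtration `F` and the pieces `G^{j+1-p} ∩ M_j` are complementary. -/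
theorem oppositePart_compl (hG : Antitone G) (hM : Monotone M) (hbot : ∃ k, M k = ⊥)
    (h : ∀ k p, IsCompl (inducedGr M (F p) k) (inducedGr M (G (k + 1 - p)) k)) (m p : ℤ) :
    (∀ x ∈ M m, ∃ f ∈ F p ⊓ M m, ∃ a ∈ oppositePart G M m p, f + a = x) ∧
      Disjoint (F p) (oppositePart G M m p) := by
  obtain ⟨b, hb⟩ := hbot
  have hle : ∀ m ≤ b, M m = ⊥ := fun m hm => le_bot_iff.1 (hb ▸ hM hm)
  rcases le_total m b with hmb | hmb
  · refine ⟨fun x hx => ?_, ?_⟩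
    · rw [hle m hmb, Submodule.mem_bot] at hx
      exact ⟨0, Submodule.zero_mem _, 0, Submodule.zero_mem _, by simp [hx]⟩
    · refine Disjoint.mono_right (oppositePart_le hM m p) ?_
      rw [hle m hmb]; exact disjoint_bot_right
  induction m, hmb using Int.leInduction with
  | base =>
    refine ⟨fun x hx => ?_, ?_⟩
    · rw [hb, Submodule.mem_bot] at hx
      exact ⟨0, Submodule.zero_mem _, 0, Submodule.zero_mem _, by simp [hx]⟩
    · refine Disjoint.mono_right (oppositePart_le hM b p) ?_
      rw [hb]; exact disjoint_bot_right
  | succ m _ ih =>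
    obtain ⟨ih1, ih2⟩ := ih
    have e : m + 1 - 1 = m := by ring
    refine ⟨fun x hx => ?_, ?_⟩
    · have hc : toGr M (m + 1) ⟨x, hx⟩ ∈
          inducedGr M (F p) (m + 1) ⊔ inducedGr M (G (m + 1 + 1 - p)) (m + 1) := by
        rw [(h (m + 1) p).sup_eq_top]; trivial
      obtain ⟨c, hc, d, hd, hcd⟩ := Submodule.mem_sup.1 hc
      obtain ⟨f, hf, rfl⟩ := mem_inducedGr.1 hc
      obtain ⟨g, hg, rfl⟩ := mem_inducedGr.1 hd
      rw [← map_add, eq_comm, toGr_eq_iff, e] at hcd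
      -- Lifts of the two parts of the class of `x` miss `x` by an element of `M m`, to which the
      -- induction hypothesis applies.
      obtain ⟨f', hf', a, ha, hfa⟩ := ih1 _ hcd
      refine ⟨f + f', ⟨Submodule.add_mem _ hf hf'.1,
        Submodule.add_mem _ f.2 (hM (by omega) hf'.2)⟩, g + a,
        mem_oppositePart_iff.2 ⟨g, ⟨hg, g.2⟩, a, by rwa [e], rfl⟩, ?_⟩
      have : (x : V) - (f + g) = f' + a := by rw [hfa]; rfl
      rw [sub_eq_iff_eq_add] at this
      rw [this]; abel
    · rw [Submodule.disjoint_def] at ih2 ⊢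
      intro x hxF hxA
      have hxM := oppositePart_le hM _ _ hxA
      obtain ⟨g, hg, a, ha, rfl⟩ := mem_oppositePart_iff.1 hxA
      rw [e] at ha
      have haM := oppositePart_le hM _ _ ha
      have h1 : toGr M (m + 1) ⟨g + a, hxM⟩ = toGr M (m + 1) ⟨g, hg.2⟩ := by
        rw [toGr_eq_iff, e]; simpa using haM
      -- The class of `g` is also that of `g + a ∈ F p`, so purity kills it. Hence `g` drops to `M
      -- m` and is absorbed by the piece of index `m`.
      have h2 : toGr M (m + 1) ⟨g, hg.2⟩ = 0 :=
        Submodule.disjoint_def.1 (h (m + 1) p).disjoint _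
          (mem_inducedGr.2 ⟨_, hxF, h1⟩) (mem_inducedGr.2 ⟨_, hg.1, rfl⟩)
      rw [← map_zero (toGr M (m + 1)), toGr_eq_iff, e] at h2
      have hgM : g ∈ M m := by simpa using h2
      refine ih2 _ hxF (Submodule.add_mem _ ?_ ha)
      exact inf_le_oppositePart le_rfl ⟨hG (by omega) hg.1, hgM⟩

end DeligneSplitting

section DeligneBigrading

variable {V : Type*} [NormedAddCommGroup V] [NormedSpace ℂ V] [Module ℚ V]
  {R : RationalStructure V} {F M : ℤ → Submodule ℂ V}

/-- A linear map out of a base change is determined by its values on `VQ`; this is applied to the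
quotient map by the span. -/
theorem RationalStructure.span_VQ (R : RationalStructure V) :
    Submodule.span ℂ (R.VQ : Set V) = ⊤ := by
  rw [eq_top_iff]
  have : (Submodule.span ℂ (R.VQ : Set V)).mkQ = 0 :=
    R.isBaseChange.algHom_ext _ _ fun x => by
      simpa using Submodule.subset_span x.2
  intro x _
  have := LinearMap.congr_fun this x
  simpa using this

theorem RationalStructure.conj_comm (R : RationalStructure V) (N : V →L[ℂ] V)
    (hN : ∀ v ∈ R.VQ, N v ∈ R.VQ) (v : V) : R.conj (N v) = N (R.conj v) := by
  have hv : v ∈ Submodule.span ℂ (R.VQ : Set V) := by rw [R.span_VQ]; trivial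
  induction hv using Submodule.span_induction with
  | mem x hx => rw [R.conj_eq_self x hx, R.conj_eq_self _ (hN x hx)]
  | zero => simp
  | add x y _ _ hx hy => simp [hx, hy]
  | smul a x _ hx => simp [hx, LinearMap.map_smulₛₗ]

namespace IsMixedHodgeStructure

theorem antitone_conj (h : IsMixedHodgeStructure R F M) :
    Antitone fun q => R.conjSubspace (F q) :=
  fun _ _ hpq => Submodule.comap_mono (h.dec.anti hpq)

/-- The filtration opposite to `F`: `⨆_j conj F^{j+1-p} ∩ M_j`. -/
theorem exists_opposite (h : IsMixedHodgeStructure R F M) : ∃ A : ℤ → Submodule ℂ V,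
    Monotone A ∧ (∀ p, IsCompl (F p) (A p)) ∧ ∀ p, hodgeU R F M p ≤ F p ⊓ A (p + 1) := by
  obtain ⟨t, ht⟩ := h.inc.top
  refine ⟨oppositePart (fun q => R.conjSubspace (F q)) M t,
    oppositePart_mono h.antitone_conj t, fun p => ?_, fun p => iSup_le fun q => ?_⟩
  · obtain ⟨h1, h2⟩ := oppositePart_compl (F := F) h.antitone_conj h.inc.mono h.inc.bot h.pure t p
    refine ⟨h2, codisjoint_iff.2 (eq_top_iff.2 fun x _ => ?_)⟩
    obtain ⟨f, hf, a, ha, rfl⟩ := h1 x (by rw [ht]; trivial)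
    exact Submodule.add_mem_sup hf.1 ha
  · have key : ∀ j, R.conjSubspace (F (j - p)) ⊓ M j ≤
        oppositePart (fun q => R.conjSubspace (F q)) M t (p + 1) := by
      intro j
      rcases le_total j t with hj | hj
      · refine le_trans (le_of_eq ?_) (inf_le_oppositePart hj)
        rw [show j + 1 - (p + 1) = j - p by ring]
      · refine le_trans ?_ (inf_le_oppositePart le_rfl)
        rw [ht]
        refine inf_le_inf (h.antitone_conj ?_) le_top
        linarith
    refine inf_le_inf inf_le_left (sup_le ?_ (iSup_le fun i => ?_))
    · exact le_trans (le_of_eq (by rw [show p + q - p = q by ring])) (key (p + q))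
    -- Deligne's correction terms sit in weight `j = p + q - i - 2` and need only `conj F^{j-p} =
    -- conj F^{q-i-2}`, one step weaker than what they satisfy.
    · refine le_trans (inf_le_inf_right _ (h.antitone_conj ?_)) (key _)
      linarith

/-- Shows that corrections in weight below `k` are admissible in Deligne's formula for `I^{p,k-p}`:
the piece of index `k - 1` goes into the main term, and the piece of index `j ≤ k - 2` is exactly
the term `i = k - 2 - j`. -/
theorem oppositePart_le_deligne (h : IsMixedHodgeStructure R F M) (k p : ℤ) :
    oppositePart (fun q => R.conjSubspace (F q)) M (k - 1) p ≤
      (R.conjSubspace (F (k - p)) ⊓ M k) ⊔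
        ⨆ i : ℕ, R.conjSubspace (F (k - p - (i + 1))) ⊓ M (k - (i + 1) - 1) := by
  refine iSup₂_le fun j hj => ?_
  rcases hj.eq_or_lt with rfl | hj
  · exact le_sup_of_le_left (inf_le_inf (h.antitone_conj (by linarith)) (h.inc.mono (by linarith)))
  · have : ((k - 2 - j).toNat : ℤ) = k - 2 - j := Int.toNat_of_nonneg (by omega)
    refine le_sup_of_le_right (le_iSup_of_le (k - 2 - j).toNat ?_)
    rw [this]
    exact inf_le_inf (h.antitone_conj (by linarith)) (h.inc.mono (by linarith))

/-- Induction on the weight. On `Gr_k` the induced filtration and its conjugate are opposite, so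
classes in `F^p ∩ conj F^{k-p}` span. Such a class has lifts `f` and `g` in the two filtrations;
writing `f - g = f' + a` in `M_{k-1}`, the element `f - f' = g + a` is a lift in `I^{p,k-p}`. -/
theorem iSup_hodgeU (h : IsMixedHodgeStructure R F M) : ⨆ p, hodgeU R F M p = ⊤ := by
  obtain ⟨b, hb⟩ := h.inc.bot
  obtain ⟨t, ht⟩ := h.inc.top
  have key : ∀ m : ℕ, M (b + m) ≤ ⨆ p, hodgeU R F M p := by
    intro m
    induction m with
    | zero => simp [hb]
    | succ m ih =>
      set k : ℤ := b + ((m + 1 : ℕ) : ℤ) with hk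
      have hk1 : k - 1 = b + m := by rw [hk]; push_cast; ring
      have hGr : inducedGr M (⨆ p, hodgeU R F M p) k = ⊤ := by
        have hF : Antitone fun p => inducedGr M (F p) k := fun p q hpq =>
          Submodule.map_mono fun x hx => h.dec.anti hpq hx
        rw [eq_top_iff, ← iSup_inf_eq_top_of_opposite
          (A := fun p => inducedGr M (R.conjSubspace (F (k + 1 - p))) k) hF (h.pure k) ?_ ?_]
        · refine iSup_le fun p => ?_
          rintro c ⟨hc1, hc2⟩
          obtain ⟨f, hf, rfl⟩ := mem_inducedGr.1 hc1
          obtain ⟨g, hg, hfg⟩ := mem_inducedGr.1 hc2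
          rw [eq_comm, toGr_eq_iff] at hfg
          obtain ⟨f', hf', a, ha, hfa⟩ := (oppositePart_compl (F := F) h.antitone_conj h.inc.mono
            h.inc.bot h.pure (k - 1) p).1 _ hfg
          have hq : k + 1 - (p + 1) = k - p := by ring
          have hpq : p + (k - p) = k := by ring
          rw [hq] at hg
          have hf'M : f' ∈ M k := h.inc.mono (by omega) hf'.2
          have hy : (f : V) - f' ∈ deligneI R F M p (k - p) := by
            refine ⟨⟨Submodule.sub_mem _ hf hf'.1, ?_⟩, ?_⟩
            · rw [hpq]; exact Submodule.sub_mem _ f.2 hf'M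
            · have ey : (f : V) - f' = g + a := by
                rw [sub_eq_iff_eq_add.1 hfa.symm]; abel
              rw [ey, hpq]
              exact Submodule.add_mem _ (Submodule.mem_sup_left ⟨hg, g.2⟩)
                (h.oppositePart_le_deligne k p ha)
          refine mem_inducedGr.2 ⟨⟨(f : V) - f', Submodule.sub_mem _ f.2 hf'M⟩,
            Submodule.mem_iSup_of_mem p (Submodule.mem_iSup_of_mem (k - p) hy), ?_⟩
          rw [toGr_eq_iff]
          simpa using Submodule.neg_mem _ hf'.2
        · obtain ⟨p, hp⟩ := h.dec.bot
          refine ⟨p, (Submodule.eq_bot_iff _).2 fun c hc => ?_⟩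
          obtain ⟨x, hx, rfl⟩ := mem_inducedGr.1 hc
          rw [hp, Submodule.mem_bot] at hx
          rw [show x = 0 from Subtype.ext hx, map_zero]
        · obtain ⟨p, hp⟩ := h.dec.top
          refine ⟨p, eq_top_iff.2 fun c _ => ?_⟩
          obtain ⟨x, rfl⟩ := toGr_surjective M k c
          exact mem_inducedGr.2 ⟨x, by rw [hp]; trivial, rfl⟩
      intro x hx
      have : toGr M k ⟨x, hx⟩ ∈ inducedGr M (⨆ p, hodgeU R F M p) k := by rw [hGr]; trivial
      obtain ⟨y, hy, hxy⟩ := mem_inducedGr.1 this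
      rw [eq_comm, toGr_eq_iff, hk1] at hxy
      have := Submodule.add_mem _ (ih hxy) hy
      simpa using this
  rw [eq_top_iff, ← ht]
  exact (h.inc.mono (by omega : t ≤ b + (t - b).toNat)).trans (key _)

theorem iSupIndep_hodgeU (h : IsMixedHodgeStructure R F M) : iSupIndep (hodgeU R F M) := by
  obtain ⟨A, hA, hFA, hU⟩ := h.exists_opposite
  exact (iSupIndep_inf_of_opposite h.dec.anti hA fun p => (hFA p).disjoint).mono hU

theorem exists_bound_hodgeU (h : IsMixedHodgeStructure R F M) :
    ∃ B : ℕ, ∀ p : ℤ, (B : ℤ) < |p| → hodgeU R F M p = ⊥ := by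
  obtain ⟨A, hA, hFA, hU⟩ := h.exists_opposite
  obtain ⟨b, hb⟩ := h.dec.bot
  obtain ⟨t, ht⟩ := h.dec.top
  refine ⟨b.natAbs + t.natAbs, fun p hp => le_bot_iff.1 ((hU p).trans ?_)⟩
  rcases lt_abs.1 hp with hp | hp
  · exact inf_le_left.trans (hb ▸ h.dec.anti (by omega))
  · have : A t = ⊥ := by have := (hFA t).inf_eq_bot; rwa [ht, top_inf_eq] at this
    exact inf_le_right.trans (this ▸ hA (by omega))

end IsMixedHodgeStructure

/-- A rational `N` commutes with conjugation, so it also lowers `conj F` by one; every constituent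
of Deligne's formula is shifted by (-1,-1). -/
theorem map_deligneI_le (N : V →L[ℂ] V) (hR : ∀ v ∈ R.VQ, N v ∈ R.VQ)
    (hF : ∀ p, ∀ v ∈ F p, N v ∈ F (p - 1)) (hM : ∀ k, ∀ v ∈ M k, N v ∈ M (k - 2)) (p q : ℤ) :
    deligneI R F M p q ≤ (deligneI R F M (p - 1) (q - 1)).comap (N : V →ₗ[ℂ] V) := by
  have hk : p - 1 + (q - 1) = p + q - 2 := by ring
  have key : ∀ a k, R.conjSubspace (F a) ⊓ M k ≤
      (R.conjSubspace (F (a - 1)) ⊓ M (k - 2)).comap (N : V →ₗ[ℂ] V) := by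
    rintro a k v ⟨hv1, hv2⟩
    refine ⟨?_, hM k v hv2⟩
    change R.conj (N v) ∈ F (a - 1)
    rw [R.conj_comm N hR]
    exact hF a _ hv1
  rintro v ⟨⟨hv1, hv2⟩, hv3⟩
  refine ⟨⟨hF p v hv1, ?_⟩, ?_⟩
  · rw [hk]; exact hM _ v hv2
  · suffices h : ((R.conjSubspace (F q) ⊓ M (p + q)) ⊔
        ⨆ i : ℕ, R.conjSubspace (F (q - (i + 1))) ⊓ M (p + q - (i + 1) - 1)) ≤
        ((R.conjSubspace (F (q - 1)) ⊓ M (p - 1 + (q - 1))) ⊔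
        ⨆ i : ℕ, R.conjSubspace (F (q - 1 - (i + 1))) ⊓
          M (p - 1 + (q - 1) - (i + 1) - 1)).comap (N : V →ₗ[ℂ] V) from h hv3
    refine sup_le ?_ (iSup_le fun i => ?_)
    · refine (key _ _).trans (Submodule.comap_mono (le_sup_of_le_left ?_))
      rw [hk]
    · refine (key _ _).trans (Submodule.comap_mono (le_sup_of_le_right (le_iSup_of_le i ?_)))
      rw [hk, show q - (i + 1) - 1 = q - 1 - ((i : ℤ) + 1) by ring,
        show p + q - (i + 1) - 1 - 2 = p + q - 2 - ((i : ℤ) + 1) - 1 by ring]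

theorem map_hodgeU_mem (N : V →L[ℂ] V) (hR : ∀ v ∈ R.VQ, N v ∈ R.VQ)
    (hF : ∀ p, ∀ v ∈ F p, N v ∈ F (p - 1)) (hM : ∀ k, ∀ v ∈ M k, N v ∈ M (k - 2)) (p : ℤ) :
    ∀ v ∈ hodgeU R F M p, N v ∈ hodgeU R F M (p - 1) := by
  have : hodgeU R F M p ≤ (hodgeU R F M (p - 1)).comap (N : V →ₗ[ℂ] V) :=
    iSup_le fun q => (map_deligneI_le N hR hF hM p q).trans
      (Submodule.comap_mono (le_iSup (fun q => deligneI R F M (p - 1) q) (q - 1)))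
  exact fun v hv => this hv

end DeligneBigrading

end LimitHodge

namespace LimitHodge

/-! ### Cauchy's formula and holomorphy of derivatives -/

section SeveralComplexVariables

open Metric Set MeasureTheory

variable {H : Type*} [NormedAddCommGroup H] [NormedSpace ℂ H]
  {E : Type*} [NormedAddCommGroup E] [NormedSpace ℂ E]

/-- Cauchy's estimate on the ball of radius `R / 2` about `y`, whose image stays within distance 2
of `f y`. -/
theorem norm_fderiv_le_of_mapsTo_ball {f : H → E} {x₀ : H} {R : ℝ} (hR : 0 < R)
    (hf : DifferentiableOn ℂ f (ball x₀ R)) (hm : MapsTo f (ball x₀ R) (ball (f x₀) 1)) {y : H}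
    (hy : y ∈ ball x₀ (R / 2)) : ‖fderiv ℂ f y‖ ≤ 4 / R := by
  have hsub : ball y (R / 2) ⊆ ball x₀ R := by
    refine ball_subset_ball' ?_
    rw [mem_ball] at hy; linarith
  have h := Complex.norm_fderiv_le_div_of_mapsTo_ball (R₂ := 2) (hf.mono hsub) (fun z hz => ?_)
    (half_pos hR)
  · refine h.trans (le_of_eq ?_)
    field_simp; norm_num
  · have h1 := hm (hsub hz)
    have h2 := hm (ball_subset_ball (by linarith) hy)
    rw [mem_ball] at h1 h2
    rw [mem_closedBall]
    have := dist_triangle_right (f z) (f y) (f x₀)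
    linarith

/-- Cauchy's formula for the derivative at 0 of `z ↦ f (s + z v)`; the smallness of `v` keeps the
unit disc inside the ball. -/
theorem fderiv_apply_eq_circleIntegral [CompleteSpace E] {f : H → E} {x₀ s v : H} {R : ℝ}
    (hf : DifferentiableOn ℂ f (ball x₀ R)) (hv : ‖v‖ < R / 4) (hs : s ∈ ball x₀ (R / 4)) :
    fderiv ℂ f s v = (2 * Real.pi * Complex.I : ℂ)⁻¹ •
      ∮ z in C(0, 1), ((z - 0) ^ 2)⁻¹ • f (s + z • v) := by
  have hcont : Continuous fun z : ℂ => s + z • v := by fun_prop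
  have hsub : closedBall (0 : ℂ) 1 ⊆ (fun z : ℂ => s + z • v) ⁻¹' ball x₀ R := by
    intro z hz
    rw [mem_closedBall, dist_zero_right] at hz
    rw [mem_preimage, mem_ball, dist_eq_norm]
    rw [mem_ball, dist_eq_norm] at hs
    have : ‖z • v‖ ≤ ‖v‖ := by
      rw [norm_smul]; exact mul_le_of_le_one_left (norm_nonneg _) hz
    calc ‖s + z • v - x₀‖ = ‖(s - x₀) + z • v‖ := by congr 1; abel
      _ ≤ ‖s - x₀‖ + ‖z • v‖ := norm_add_le _ _
      _ < R := by linarith [norm_nonneg v]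
  have hd : DifferentiableOn ℂ (fun z : ℂ => f (s + z • v))
      ((fun z : ℂ => s + z • v) ⁻¹' ball x₀ R) :=
    hf.comp (by fun_prop) fun z hz => hz
  rw [Complex.two_pi_I_inv_smul_circleIntegral_sub_sq_inv_smul_of_differentiable
    (isOpen_ball.preimage hcont) hsub hd (mem_ball_self one_pos)]
  have h0 : s + (0 : ℂ) • v = s := by simp
  have hs' : s ∈ ball x₀ R := ball_subset_ball (by linarith [norm_nonneg v]) hs
  have hfs : HasFDerivAt f (fderiv ℂ f s) (s + (0 : ℂ) • v) := by
    rw [h0]; exact (hf.differentiableAt (isOpen_ball.mem_nhds hs')).hasFDerivAt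
  have hl : HasDerivAt (fun z : ℂ => s + z • v) v 0 := by
    simpa using ((hasDerivAt_id (0 : ℂ)).smul_const v).const_add s
  exact (hfs.comp_hasDerivAt (0 : ℂ) hl).deriv.symm

variable [FiniteDimensional ℂ H] [FiniteDimensional ℂ E]

/-- The derivatives of a holomorphic function of several variables are holomorphic. -/
theorem _root_.DifferentiableOn.fderiv_apply_const {f : H → E} {U : Set H} (hU : IsOpen U)
    (hf : DifferentiableOn ℂ f U) (v : H) : DifferentiableOn ℂ (fun s => fderiv ℂ f s v) U := by
  intro x₀ hx₀
  refine DifferentiableAt.differentiableWithinAt ?_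
  obtain ⟨R, hR, hRU, hm⟩ : ∃ R > 0, ball x₀ R ⊆ U ∧ MapsTo f (ball x₀ R) (ball (f x₀) 1) := by
    have h1 : f ⁻¹' ball (f x₀) 1 ∈ nhds x₀ :=
      (hf.differentiableAt (hU.mem_nhds hx₀)).continuousAt (ball_mem_nhds _ one_pos)
    obtain ⟨R, hR, h⟩ := Metric.mem_nhds_iff.1 (Filter.inter_mem (hU.mem_nhds hx₀) h1)
    exact ⟨R, hR, fun x hx => (h hx).1, fun x hx => (h hx).2⟩
  replace hf := hf.mono hRU
  -- The derivative is linear in `v`, so `v` may be rescaled until Cauchy's formula over the unit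
  -- circle applies.
  suffices key : ∀ v : H, ‖v‖ < R / 4 → DifferentiableAt ℂ (fun s => fderiv ℂ f s v) x₀ by
    obtain ⟨c, hc, hcv⟩ : ∃ c : ℂ, c ≠ 0 ∧ ‖c • v‖ < R / 4 := by
      refine ⟨((R / 8 / (‖v‖ + 1) : ℝ) : ℂ), ?_, ?_⟩
      · have := norm_nonneg v
        exact Complex.ofReal_ne_zero.2 (by positivity)
      · have hv := norm_nonneg v
        rw [norm_smul, Complex.norm_real, Real.norm_of_nonneg (by positivity), div_mul_eq_mul_div,
          div_lt_iff₀ (by positivity)]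
        nlinarith
    have := (key (c • v) hcv).const_smul c⁻¹
    refine this.congr_of_eventuallyEq (Filter.Eventually.of_forall fun s => ?_)
    simp [hc]
  intro v hv
  set e : ℝ → ℂ := circleMap 0 1
  set k : ℝ → ℂ := fun θ => deriv e θ * ((e θ - 0) ^ 2)⁻¹ with hk
  have hknorm : ∀ θ, ‖k θ‖ = 1 := fun θ => by simp [hk, e]
  have hecont : Continuous e := continuous_circleMap 0 1
  have henorm : ∀ θ, ‖e θ‖ = 1 := fun θ => by simp [e]
  have hkcont : Continuous k := by
    have h1 : deriv e = fun θ => e θ * Complex.I := by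
      ext θ; simp [e, deriv_circleMap]
    rw [hk, h1]
    refine (hecont.mul continuous_const).mul (Continuous.inv₀ (by fun_prop) fun θ => ?_)
    have := henorm θ
    simp only [sub_zero]
    exact pow_ne_zero _ fun h => by rw [h] at this; simp at this
  have hmem : ∀ s ∈ ball x₀ (R / 4), ∀ θ, s + e θ • v ∈ ball x₀ (R / 2) := by
    intro s hs θ
    rw [mem_ball, dist_eq_norm] at hs ⊢
    calc ‖s + e θ • v - x₀‖ = ‖(s - x₀) + e θ • v‖ := by congr 1; abel
      _ ≤ ‖s - x₀‖ + ‖e θ • v‖ := norm_add_le _ _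
      _ < R / 2 := by rw [norm_smul, henorm]; linarith
  have hmem' : ∀ s ∈ ball x₀ (R / 4), ∀ θ, s + e θ • v ∈ ball x₀ R := fun s hs θ =>
    ball_subset_ball (by linarith) (hmem s hs θ)
  have hFcont : ∀ s ∈ ball x₀ (R / 4), Continuous fun θ => k θ • f (s + e θ • v) := by
    intro s hs
    refine hkcont.smul ?_
    exact hf.continuousOn.comp_continuous (by fun_prop) (hmem' s hs)
  have hlip : LipschitzOnWith (Real.nnabs (4 / R)) f (ball x₀ (R / 2)) := by
    let : NormedSpace ℝ H := NormedSpace.restrictScalars ℝ ℂ H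
    refine (convex_ball x₀ (R / 2)).lipschitzOnWith_of_nnnorm_fderiv_le (𝕜 := ℂ)
      (fun y hy => hf.differentiableAt (isOpen_ball.mem_nhds
        (ball_subset_ball (by linarith) hy))) fun y hy => ?_
    rw [← NNReal.coe_le_coe, coe_nnnorm, Real.coe_nnabs, abs_of_pos (by positivity)]
    exact norm_fderiv_le_of_mapsTo_ball hR hf hm hy
  have hx₀4 : x₀ ∈ ball x₀ (R / 4) := mem_ball_self (by linarith)
  let : NormedSpace ℝ E := NormedSpace.restrictScalars ℝ ℂ E
  have : CompleteSpace E := FiniteDimensional.complete ℂ E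
  have : ProperSpace (H →L[ℂ] E) := FiniteDimensional.proper ℂ _
  borelize H
  -- Cauchy's formula is differentiated under the integral sign. Continuity of `fderiv ℂ f` is not
  -- yet available; the Lipschitz form needs only its measurability and the constant `4 / R` from
  -- Cauchy's estimate.
  have hint := (intervalIntegral.hasFDerivAt_integral_of_dominated_loc_of_lip (𝕜 := ℂ)
    (μ := volume) (a := 0) (b := 2 * Real.pi) (bound := fun _ => 4 / R)
    (F := fun s θ => k θ • f (s + e θ • v))
    (F' := fun θ => k θ • fderiv ℂ f (x₀ + e θ • v)) (x₀ := x₀) (s := ball x₀ (R / 4))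
    (ball_mem_nhds _ (by linarith))
    (Filter.eventually_of_mem (ball_mem_nhds x₀ (by linarith)) fun s hs =>
      (hFcont s hs).aestronglyMeasurable)
    ((hFcont x₀ hx₀4).intervalIntegrable _ _)
    (hkcont.aestronglyMeasurable.smul
      ((measurable_fderiv ℂ f).comp (by fun_prop :
        Measurable fun θ => x₀ + e θ • v)).aestronglyMeasurable)
    (Filter.Eventually.of_forall fun θ _ => ?_)
    intervalIntegrable_const
    (Filter.Eventually.of_forall fun θ _ => ?_)).2
  · refine (hint.differentiableAt.const_smul (2 * Real.pi * Complex.I : ℂ)⁻¹).congr_of_eventuallyEq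
      (Filter.eventually_of_mem (ball_mem_nhds x₀ (by linarith : 0 < R / 4)) fun s hs => ?_)
    have : CompleteSpace E := FiniteDimensional.complete ℂ E
    refine (fderiv_apply_eq_circleIntegral hf hv hs).trans ?_
    simp only [circleIntegral, smul_smul, hk, Pi.smul_apply]
    rfl
  · refine LipschitzOnWith.of_dist_le_mul fun s hs t ht => ?_
    have := hlip.dist_le_mul _ (hmem s hs θ) _ (hmem t ht θ)
    rw [dist_add_right] at this
    rwa [dist_eq_norm, ← smul_sub, norm_smul, hknorm, one_mul, ← dist_eq_norm]
  · refine HasFDerivAt.const_smul ?_ _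
    have := (hf.differentiableAt (isOpen_ball.mem_nhds (hmem' x₀ hx₀4 θ))).hasFDerivAt
    exact (hasFDerivAt_comp_add_right _).2 this

/-- The derivative of a holomorphic function of several variables is holomorphic. -/
theorem _root_.DifferentiableOn.fderiv_of_isOpen {f : H → E} {U : Set H} (hU : IsOpen U)
    (hf : DifferentiableOn ℂ f U) : DifferentiableOn ℂ (fderiv ℂ f) U := by
  have b := Module.finBasis ℂ H
  intro x hx
  refine DifferentiableAt.differentiableWithinAt ?_
  have h : ∀ i, DifferentiableAt ℂ (fun s => fderiv ℂ f s (b i)) x := fun i =>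
    (hf.fderiv_apply_const hU (b i)).differentiableAt (hU.mem_nhds hx)
  have e : fderiv ℂ f = fun s => ∑ i, (b.coord i).toContinuousLinearMap.smulRight
      (fderiv ℂ f s (b i)) := by
    ext s v
    conv_lhs => rw [← b.sum_repr v, map_sum]
    simp
  rw [e]
  refine DifferentiableAt.fun_sum fun i _ => ?_
  exact ((ContinuousLinearMap.smulRightL ℂ H E
    ((b.coord i).toContinuousLinearMap)).differentiableAt).comp x (h i)

theorem fderiv_fderiv_comm {f : H → E} {U : Set H} (hU : IsOpen U)
    (hf : DifferentiableOn ℂ f U) {x : H} (hx : x ∈ U) (v w : H) :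
    fderiv ℂ (fun s => fderiv ℂ f s v) x w = fderiv ℂ (fun s => fderiv ℂ f s w) x v := by
  have h := (hf.fderiv_of_isOpen hU).differentiableAt (hU.mem_nhds hx)
  have e : ∀ v w, fderiv ℂ (fun s => fderiv ℂ f s v) x w = fderiv ℂ (fderiv ℂ f) x w v := by
    intro v w
    rw [fderiv_clm_apply h (differentiableAt_const v)]
    simp
  rw [e, e]
  refine second_derivative_symmetric_of_eventually (f := f) (f' := fderiv ℂ f) ?_
    h.hasFDerivAt w v
  filter_upwards [hU.mem_nhds hx] with y hy
  exact (hf.differentiableAt (hU.mem_nhds hy)).hasFDerivAt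

end SeveralComplexVariables
end LimitHodge

namespace LimitHodge

/-! ### The logarithmic Poincaré lemma on the polydisk -/

section Polydisk

open Set MeasureTheory

variable {n : ℕ} {r : ℝ} {E : Type*} [NormedAddCommGroup E] [NormedSpace ℂ E]

theorem isOpen_polydisk : IsOpen (polydisk n r) := by
  have : polydisk n r = ⋂ j, {s : Fin n → ℂ | ‖s j‖ < r} := by ext; simp [polydisk]
  rw [this]
  exact isOpen_iInter_of_finite fun j => isOpen_lt (by fun_prop) continuous_const

theorem zero_mem_polydisk (hr : 0 < r) : (0 : Fin n → ℂ) ∈ polydisk n r := fun j => by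
  simpa using hr

theorem smul_mem_polydisk {s : Fin n → ℂ} (hs : s ∈ polydisk n r) {t : ℝ} (h0 : 0 ≤ t)
    (h1 : t ≤ 1) : (t : ℂ) • s ∈ polydisk n r := fun j => by
  rw [Pi.smul_apply, norm_smul, Complex.norm_real, Real.norm_of_nonneg h0]
  exact (mul_le_of_le_one_left (norm_nonneg _) h1).trans_lt (hs j)

theorem smul_mem_puncturedPolydisk {s : Fin n → ℂ} (hs : s ∈ puncturedPolydisk n r) {t : ℝ}
    (h0 : 0 < t) (h1 : t ≤ 1) : (t : ℂ) • s ∈ puncturedPolydisk n r :=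
  ⟨smul_mem_polydisk hs.1 h0.le h1, fun j =>
    smul_ne_zero (Complex.ofReal_ne_zero.2 h0.ne') (hs.2 j)⟩

theorem polydisk_subset_closure : polydisk n r ⊆ closure (puncturedPolydisk n r) := by
  have hd : Dense {s : Fin n → ℂ | ∀ j, s j ≠ 0} := by
    have : {s : Fin n → ℂ | ∀ j, s j ≠ 0} = Set.pi univ fun _ => {0}ᶜ := by ext; simp
    rw [this]
    exact dense_pi univ fun _ _ => dense_compl_singleton 0
  exact hd.open_subset_closure_inter isOpen_polydisk

theorem eqOn_polydisk {X : Type*} [TopologicalSpace X] [T2Space X] {f g : (Fin n → ℂ) → X}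
    (hf : ContinuousOn f (polydisk n r)) (hg : ContinuousOn g (polydisk n r))
    (h : EqOn f g (puncturedPolydisk n r)) : EqOn f g (polydisk n r) :=
  h.of_subset_closure hf hg (fun _ hs => hs.1) polydisk_subset_closure

theorem isOpen_puncturedPolydisk : IsOpen (puncturedPolydisk n r) := by
  have : puncturedPolydisk n r = polydisk n r ∩ ⋂ j, {s : Fin n → ℂ | s j ≠ 0} := by
    ext; simp [puncturedPolydisk]
  rw [this]
  exact isOpen_polydisk.inter
    (isOpen_iInter_of_finite fun j => isOpen_ne_fun (by fun_prop) continuous_const)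

/-- The logarithmic derivation `s_j ∂/∂s_j`. -/
noncomputable def eulerDeriv (j : Fin n) (f : (Fin n → ℂ) → E) (s : Fin n → ℂ) : E :=
  s j • pderiv j f s

theorem fderiv_apply_eq_sum (f : (Fin n → ℂ) → E) (s v : Fin n → ℂ) :
    fderiv ℂ f s v = ∑ j, v j • pderiv j f s := by
  conv_lhs => rw [pi_eq_sum_univ' v, map_sum]
  refine Finset.sum_congr rfl fun j _ => ?_
  rw [map_smul, pderiv]

theorem fderiv_smul_apply (f : (Fin n → ℂ) → E) (s : Fin n → ℂ) (t : ℂ) :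
    t • fderiv ℂ f (t • s) s = ∑ j, eulerDeriv j f (t • s) := by
  rw [fderiv_apply_eq_sum, Finset.smul_sum]
  exact Finset.sum_congr rfl fun j _ => by simp [eulerDeriv, smul_smul]

theorem hasDerivAt_ray {f : (Fin n → ℂ) → E} (hf : DifferentiableOn ℂ f (polydisk n r))
    {s : Fin n → ℂ} {t : ℝ} (hs : (t : ℂ) • s ∈ polydisk n r) :
    HasDerivAt (fun u : ℝ => f ((u : ℂ) • s)) (fderiv ℂ f ((t : ℂ) • s) s) t := by
  have h1 : HasFDerivAt f (fderiv ℂ f ((t : ℂ) • s)) ((t : ℂ) • s) :=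
    (hf.differentiableAt (isOpen_polydisk.mem_nhds hs)).hasFDerivAt
  have h2 : HasDerivAt (fun u : ℝ => (u : ℂ) • s) s t := by
    simpa using (Complex.ofRealCLM.hasDerivAt (x := t)).smul_const s
  exact (h1.restrictScalars ℝ).comp_hasDerivAt t h2

/-- Along the ray through `s`, `t d/dt f(ts) = ∑ θ_j f (ts) = 0`, so `f` is constant for `0 < t ≤
1`; continuity reaches `t = 0`, and density of the punctured polydisk gives the remaining points. -/
theorem eqOn_of_eulerDeriv_eq_zero {f : (Fin n → ℂ) → E}
    (hf : DifferentiableOn ℂ f (polydisk n r))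
    (h : ∀ s ∈ puncturedPolydisk n r, ∀ j, eulerDeriv j f s = 0) :
    EqOn f (fun _ => f 0) (polydisk n r) := by
  refine eqOn_polydisk hf.continuousOn continuousOn_const fun s hs => ?_
  have hd : ∀ t ∈ Icc (0 : ℝ) 1, HasDerivAt (fun u : ℝ => f ((u : ℂ) • s))
      (fderiv ℂ f ((t : ℂ) • s) s) t := fun t ht =>
    hasDerivAt_ray hf (smul_mem_polydisk hs.1 ht.1 ht.2)
  have hcont : ContinuousOn (fun u : ℝ => f ((u : ℂ) • s)) (Icc 0 1) := fun t ht =>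
    (hd t ht).continuousAt.continuousWithinAt
  have hzero : ∀ t ∈ Ioc (0 : ℝ) 1, fderiv ℂ f ((t : ℂ) • s) s = 0 := by
    intro t ht
    have ht0 : (t : ℂ) ≠ 0 := Complex.ofReal_ne_zero.2 ht.1.ne'
    refine (smul_eq_zero_iff_right ht0).1 ?_
    rw [fderiv_smul_apply]
    exact Finset.sum_eq_zero fun j _ => h _ (smul_mem_puncturedPolydisk hs ht.1 ht.2) j
  have hconst : EqOn (fun u : ℝ => f ((u : ℂ) • s)) (fun _ => f s) (Ioc 0 1) := by
    intro t ht
    have := (convex_Ioc (0 : ℝ) 1).norm_image_sub_le_of_norm_hasDerivWithin_le (C := 0)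
      (f := fun u : ℝ => f ((u : ℂ) • s)) (f' := fun t => fderiv ℂ f ((t : ℂ) • s) s)
      (fun t ht => (hd t ⟨ht.1.le, ht.2⟩).hasDerivWithinAt) (fun t ht => by rw [hzero t ht]; simp)
      (right_mem_Ioc.2 one_pos) ht
    simpa [sub_eq_zero] using this
  have := hconst.of_subset_closure hcont continuousOn_const Ioc_subset_Icc_self
    (closure_Ioc (zero_ne_one' ℝ)).ge (left_mem_Icc.2 zero_le_one)
  simpa using this.symm

variable [FiniteDimensional ℂ E]

/-- Provides the dominating constant for integrals along rays: the rays from 0 to a closed ball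
sweep out a compact subset of the polydisk. -/
theorem exists_fderiv_bound {f : (Fin n → ℂ) → E} (hf : DifferentiableOn ℂ f (polydisk n r))
    {x₀ : Fin n → ℂ} (hx₀ : x₀ ∈ polydisk n r) : ∃ δ > 0, ∃ C : ℝ,
      Metric.closedBall x₀ δ ⊆ polydisk n r ∧
      ∀ x ∈ Metric.closedBall x₀ δ, ∀ t ∈ Icc (0 : ℝ) 1, ‖fderiv ℂ f ((t : ℂ) • x)‖ ≤ C := by
  obtain ⟨δ, hδ, hsub⟩ := Metric.nhds_basis_closedBall.mem_iff.1 (isOpen_polydisk.mem_nhds hx₀)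
  have hK : IsCompact ((fun p : ℝ × (Fin n → ℂ) => (p.1 : ℂ) • p.2) ''
      (Icc 0 1 ×ˢ Metric.closedBall x₀ δ)) :=
    (isCompact_Icc.prod (isCompact_closedBall x₀ δ)).image (by fun_prop)
  obtain ⟨C, hC⟩ := hK.exists_bound_of_continuousOn (f := fderiv ℂ f)
    ((hf.fderiv_of_isOpen isOpen_polydisk).continuousOn.mono (by
      rintro _ ⟨⟨t, x⟩, ⟨ht, hx⟩, rfl⟩
      exact smul_mem_polydisk (hsub hx) ht.1 ht.2))
  exact ⟨δ, hδ, C, hsub, fun x hx t ht => hC _ ⟨(t, x), ⟨ht, hx⟩, rfl⟩⟩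

/-- The Euler vector field `∑ s_j ∂/∂s_j` can be inverted on holomorphic functions vanishing at the
origin, by integrating along rays. -/
theorem hasFDerivAt_integral_ray {B : (Fin n → ℂ) → E} (hB : DifferentiableOn ℂ B (polydisk n r))
    (hB0 : B 0 = 0) {s : Fin n → ℂ} (hs : s ∈ polydisk n r) :
    HasFDerivAt (fun s => ∫ t in (0 : ℝ)..1, (t : ℂ)⁻¹ • B ((t : ℂ) • s))
      (∫ t in (0 : ℝ)..1, fderiv ℂ B ((t : ℂ) • s)) s := by
  obtain ⟨δ, hδ, C, hsub, hC⟩ := exists_fderiv_bound hB hs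
  have hmeas : ∀ x ∈ polydisk n r, AEStronglyMeasurable
      (fun t : ℝ => (t : ℂ)⁻¹ • B ((t : ℂ) • x)) (volume.restrict (uIoc 0 1)) := by
    intro x hx
    rw [uIoc_of_le zero_le_one]
    refine ContinuousOn.aestronglyMeasurable ?_ measurableSet_Ioc
    refine ContinuousOn.smul (ContinuousOn.inv₀ (by fun_prop) fun t ht =>
      Complex.ofReal_ne_zero.2 ht.1.ne') ?_
    exact hB.continuousOn.comp (by fun_prop) fun t ht => smul_mem_polydisk hx ht.1.le ht.2
  have hcont' : ContinuousOn (fun t : ℝ => fderiv ℂ B ((t : ℂ) • s)) (Icc 0 1) :=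
    (hB.fderiv_of_isOpen isOpen_polydisk).continuousOn.comp (by fun_prop)
      fun t ht => smul_mem_polydisk hs ht.1 ht.2
  refine intervalIntegral.hasFDerivAt_integral_of_dominated_of_fderiv_le (𝕜 := ℂ)
    (bound := fun _ => C) (F' := fun x t => fderiv ℂ B ((t : ℂ) • x))
    (Metric.closedBall_mem_nhds s hδ)
    (Filter.eventually_of_mem (isOpen_polydisk.mem_nhds hs) hmeas) ?_ ?_ ?_
    intervalIntegrable_const ?_
  · rw [intervalIntegrable_iff]
    refine IntegrableOn.of_bound (by simp) (hmeas s hs) (C * ‖s‖) ?_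
    refine (ae_restrict_iff' measurableSet_uIoc).2 (Filter.Eventually.of_forall fun t ht => ?_)
    rw [uIoc_of_le zero_le_one] at ht
    have hsc : s ∈ Metric.closedBall s δ := Metric.mem_closedBall_self hδ.le
    -- Since `B 0 = 0`, the mean value inequality gives `‖B (t s)‖ ≤ C ‖s‖ t`, which compensates the
    -- factor `t⁻¹`.
    have := norm_image_sub_le_of_norm_deriv_le_segment' (a := (0 : ℝ)) (b := 1)
      (f := fun u : ℝ => B ((u : ℂ) • s)) (f' := fun t => fderiv ℂ B ((t : ℂ) • s) s)
      (C := C * ‖s‖)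
      (fun u hu => (hasDerivAt_ray hB (smul_mem_polydisk hs hu.1 hu.2)).hasDerivWithinAt)
      (fun u hu => (ContinuousLinearMap.le_opNorm _ _).trans
        (mul_le_mul_of_nonneg_right (hC s hsc u ⟨hu.1, hu.2.le⟩) (norm_nonneg _)))
      t ⟨ht.1.le, ht.2⟩
    simp only [Complex.ofReal_zero, zero_smul, hB0, sub_zero] at this
    rw [norm_smul, norm_inv, Complex.norm_real, Real.norm_of_nonneg ht.1.le,
      inv_mul_le_iff₀ ht.1, mul_comm]
    exact this
  · rw [uIoc_of_le zero_le_one]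
    exact (hcont'.mono Ioc_subset_Icc_self).aestronglyMeasurable measurableSet_Ioc
  · refine Filter.Eventually.of_forall fun t ht x hx => ?_
    rw [uIoc_of_le zero_le_one] at ht
    exact hC x hx t ⟨ht.1.le, ht.2⟩
  · refine Filter.Eventually.of_forall fun t ht x hx => ?_
    rw [uIoc_of_le zero_le_one] at ht
    have ht0 : (t : ℂ) ≠ 0 := Complex.ofReal_ne_zero.2 ht.1.ne'
    have h1 : HasFDerivAt B (fderiv ℂ B ((t : ℂ) • x)) ((t : ℂ) • x) :=
      (hB.differentiableAt (isOpen_polydisk.mem_nhds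
        (smul_mem_polydisk (hsub hx) ht.1.le ht.2))).hasFDerivAt
    have h2 := (h1.comp x ((hasFDerivAt_id x).const_smul (t : ℂ))).const_smul (t : ℂ)⁻¹
    refine h2.congr_fderiv ?_
    ext v
    change (t : ℂ)⁻¹ • fderiv ℂ B ((t : ℂ) • x) ((t : ℂ) • v) = _
    rw [map_smul, smul_smul, inv_mul_cancel₀ ht0, one_smul]

/-- The logarithmic Poincaré lemma on the polydisk: a closed form `∑ b_j ds_j / s_j` with `b_j`
holomorphic and `b_j(0) = 0` has a holomorphic primitive. -/
theorem exists_log_primitive {b : Fin n → (Fin n → ℂ) → E}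
    (hb : ∀ j, DifferentiableOn ℂ (b j) (polydisk n r)) (hb0 : ∀ j, b j 0 = 0)
    (hclosed : ∀ s ∈ puncturedPolydisk n r, ∀ i j,
      eulerDeriv i (b j) s = eulerDeriv j (b i) s) :
    ∃ f : (Fin n → ℂ) → E, DifferentiableOn ℂ f (polydisk n r) ∧ f 0 = 0 ∧
      ∀ s ∈ puncturedPolydisk n r, ∀ j, eulerDeriv j f s = b j s := by
  set B : (Fin n → ℂ) → E := fun s => ∑ j, b j s with hBdef
  have hB : DifferentiableOn ℂ B (polydisk n r) := DifferentiableOn.fun_sum fun j _ => hb j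
  have hB0 : B 0 = 0 := by simp [hBdef, hb0]
  refine ⟨fun s => ∫ t in (0 : ℝ)..1, (t : ℂ)⁻¹ • B ((t : ℂ) • s),
    fun s hs => (hasFDerivAt_integral_ray hB hB0 hs).differentiableAt.differentiableWithinAt,
    by simp [hB0], fun s hs j => ?_⟩
  have hcont : ∀ {g : (Fin n → ℂ) → E}, DifferentiableOn ℂ g (polydisk n r) →
      ContinuousOn (fun t : ℝ => fderiv ℂ g ((t : ℂ) • s)) (uIcc 0 1) := by
    intro g hg
    rw [uIcc_of_le zero_le_one]
    exact (hg.fderiv_of_isOpen isOpen_polydisk).continuousOn.comp (by fun_prop)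
      fun t ht => smul_mem_polydisk hs.1 ht.1 ht.2
  have hint : ∀ {g : (Fin n → ℂ) → E}, DifferentiableOn ℂ g (polydisk n r) → ∀ v,
      IntervalIntegrable (fun t : ℝ => fderiv ℂ g ((t : ℂ) • s) v) volume 0 1 := fun hg v =>
    ((hcont hg).clm_apply continuousOn_const).intervalIntegrable
  rw [eulerDeriv, pderiv, (hasFDerivAt_integral_ray hB hB0 hs.1).fderiv,
    ContinuousLinearMap.intervalIntegral_apply (hcont hB).intervalIntegrable,
    ← intervalIntegral.integral_smul]
  -- Closedness turns `∑ θ_j b_i` into `∑ θ_i b_j`, which at `ts` is `t d/dt b_j(ts)`. The integrand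
  -- of `θ_j f` is therefore a total derivative, with integral `b_j(s) - b_j(0)`.
  have hftc := intervalIntegral.integral_eq_sub_of_hasDerivAt (a := (0 : ℝ)) (b := 1)
    (f := fun u : ℝ => b j ((u : ℂ) • s)) (f' := fun t => fderiv ℂ (b j) ((t : ℂ) • s) s)
    (fun t ht => by
      rw [uIcc_of_le zero_le_one] at ht
      exact hasDerivAt_ray (hb j) (smul_mem_polydisk hs.1 ht.1 ht.2)) (hint (hb j) s)
  simp only [Complex.ofReal_one, one_smul, Complex.ofReal_zero, zero_smul, hb0, sub_zero] at hftc
  rw [← hftc]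
  refine intervalIntegral.integral_congr_ae (Filter.Eventually.of_forall fun t ht => ?_)
  rw [uIoc_of_le zero_le_one] at ht
  have ht0 : (t : ℂ) ≠ 0 := Complex.ofReal_ne_zero.2 ht.1.ne'
  have hts := smul_mem_puncturedPolydisk hs ht.1 ht.2
  refine smul_right_injective E ht0 ?_
  change (t : ℂ) • (s j • pderiv j B ((t : ℂ) • s)) = (t : ℂ) • fderiv ℂ (b j) ((t : ℂ) • s) s
  rw [fderiv_smul_apply, smul_smul]
  have : pderiv j B ((t : ℂ) • s) = ∑ i, pderiv j (b i) ((t : ℂ) • s) := by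
    rw [hBdef, pderiv, fderiv_fun_sum fun i _ =>
      (hb i).differentiableAt (isOpen_polydisk.mem_nhds hts.1)]
    simp [pderiv]
  rw [this, Finset.smul_sum]
  exact Finset.sum_congr rfl fun i _ => hclosed _ hts j i

end Polydisk
end LimitHodge

namespace LimitHodge

noncomputable section

open NormedSpace (exp)

/-! ### The exponential and its logarithmic derivative -/

section Exponential

variable {A : Type*} [NormedRing A] [NormedAlgebra ℂ A]

/-- The adjoint operator `[x, ·]`. -/
def adjointOp (x : A) : A →L[ℂ] A :=
  ContinuousLinearMap.mul ℂ A x - (ContinuousLinearMap.mul ℂ A).flip x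

theorem adjointOp_apply (x y : A) : adjointOp x y = x * y - y * x := rfl

theorem eq_of_hasDerivAt_zero {f : ℂ → A} (h : ∀ t, HasDerivAt f 0 t) : f 1 = f 0 :=
  is_const_of_deriv_eq_zero (fun t => (h t).differentiableAt) (fun t => (h t).deriv) 1 0

variable [FiniteDimensional ℂ A]

theorem exp_hasSum (x : A) : HasSum (fun k => ((k.factorial : ℂ))⁻¹ • x ^ k) (exp x) := by
  have := FiniteDimensional.complete ℂ A
  exact NormedSpace.exp_series_hasSum_exp' (𝕂 := ℂ) x

theorem exp_neg_mul_exp (x : A) : exp (-x) * exp x = 1 := by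
  have := FiniteDimensional.complete ℂ A
  let _ := NormedAlgebra.restrictScalars ℚ ℂ A
  rw [← NormedSpace.exp_add_of_commute (Commute.refl x).neg_left, neg_add_cancel,
    NormedSpace.exp_zero]

theorem exp_mul_exp_neg (x : A) : exp x * exp (-x) = 1 := by
  simpa using exp_neg_mul_exp (-x)

theorem differentiable_exp : Differentiable ℂ (exp : A → A) := fun x => by
  have := FiniteDimensional.complete ℂ A
  exact (NormedSpace.exp_analytic (𝕂 := ℂ) x).differentiableAt

theorem hasDerivAt_exp_smul (x : A) (t : ℂ) :
    HasDerivAt (fun u : ℂ => exp (u • x)) (x * exp (t • x)) t := by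
  have := FiniteDimensional.complete ℂ A
  exact hasDerivAt_exp_smul_const' x t

theorem hasDerivAt_exp_smul' (x : A) (t : ℂ) :
    HasDerivAt (fun u : ℂ => exp (u • x)) (exp (t • x) * x) t := by
  have := FiniteDimensional.complete ℂ A
  exact hasDerivAt_exp_smul_const x t

theorem mem_of_hasSum {Q : Submodule ℂ A} {f : ℕ → A} {x : A} (h : HasSum f x)
    (hf : ∀ k, f k ∈ Q) : x ∈ Q :=
  (Submodule.closed_of_finiteDimensional Q).mem_of_tendsto h
    (Filter.Eventually.of_forall fun _ => Submodule.sum_mem _ fun k _ => hf k)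

/-- Turns membership in a subspace into the vanishing of a continuous linear map, which commutes
with differentiation. -/
theorem exists_clm_ker_eq (Q : Submodule ℂ A) : ∃ p : A →L[ℂ] A, ∀ x, p x = 0 ↔ x ∈ Q := by
  obtain ⟨C, hC⟩ := Q.exists_isCompl
  refine ⟨LinearMap.toContinuousLinearMap (C.projection Q hC.symm), fun x => ?_⟩
  have := Submodule.ker_projection hC.symm
  exact (LinearMap.mem_ker (f := C.projection Q hC.symm)).symm.trans (by rw [this])

/-- With `T = -ad x`, the curve `e^{tx} (e^{tT} y) e^{-tx}` has zero derivative; its values at 0 and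
1 are compared. -/
theorem exp_neg_adjointOp_apply (x y : A) :
    exp (-(adjointOp x)) y = exp (-x) * y * exp x := by
  set T := -(adjointOp x) with hT
  have hE : ∀ t : ℂ, HasDerivAt (fun u : ℂ => exp (u • T) y) (T (exp (t • T) y)) t := fun t =>
    (ContinuousLinearMap.apply ℂ A y).hasFDerivAt.comp_hasDerivAt t (hasDerivAt_exp_smul T t)
  have h := eq_of_hasDerivAt_zero (f := fun t => exp (t • x) * exp (t • T) y * exp (t • (-x)))
    fun t => by
      have := ((hasDerivAt_exp_smul' x t).fun_mul (hE t)).fun_mul (hasDerivAt_exp_smul (-x) t)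
      refine this.congr_deriv ?_
      have hTa : ∀ z, T z = z * x - x * z := fun z => by simp [hT, adjointOp_apply]
      rw [hTa]
      noncomm_ring
  simp only [one_smul, zero_smul ℂ x, zero_smul ℂ (-x), NormedSpace.exp_zero, one_mul, mul_one] at h
  rw [show exp ((0 : ℂ) • T) y = y from
    (congrArg (fun S : A →L[ℂ] A => exp S y) (zero_smul ℂ T)).trans (by rw [NormedSpace.exp_zero]; rfl)] at h
  calc exp T y = exp (-x) * exp x * exp T y * (exp (-x) * exp x) := by
        rw [exp_neg_mul_exp, one_mul, mul_one]
    _ = exp (-x) * (exp x * exp T y * exp (-x)) * exp x := by noncomm_ring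
    _ = _ := by rw [h]

/-- The left logarithmic derivative of `exp` at `x` in the direction `y` is in every subspace that
contains all `e^{-tx} y e^{tx}`. -/
theorem exp_neg_mul_fderiv_exp_mem {Q : Submodule ℂ A} {x y : A}
    (h : ∀ t : ℂ, exp (-(t • x)) * y * exp (t • x) ∈ Q) :
    exp (-x) * fderiv ℂ exp x y ∈ Q := by
  set P : ℂ × A → A := fun p => exp (p.1 • p.2) with hP
  have hPd : Differentiable ℂ P := differentiable_exp.comp (by fun_prop)
  set D : ℂ → A := fun t => fderiv ℂ P (t, x) (0, y) with hD
  -- `D t` is the derivative of `z ↦ e^{tz}` at `x` in the direction `y`. Symmetry of mixed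
  -- derivatives gives the equation `D' = y e^{tx} + x D`.
  have hmix : ∀ t : ℂ, HasDerivAt D (y * exp (t • x) + x * D t) t := by
    intro t
    have h1 : (fun p : ℂ × A => fderiv ℂ P p (1, 0)) = fun p => p.2 * P p := by
      ext ⟨u, z⟩
      have hl : HasDerivAt (fun u : ℂ => (u, z)) (1, 0) u :=
        (hasDerivAt_id u).prodMk (hasDerivAt_const u z)
      have h := (hPd (u, z)).hasFDerivAt.comp_hasDerivAt u hl
      exact h.unique (f := fun u : ℂ => exp (u • z)) (hasDerivAt_exp_smul z u)
    have h2 : fderiv ℂ (fun p : ℂ × A => p.2 * P p) (t, x) (0, y) = y * exp (t • x) + x * D t := by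
      have := (hasFDerivAt_snd (𝕜 := ℂ) (p := (t, x))).fun_mul' (hPd (t, x)).hasFDerivAt
      rw [HasFDerivAt.fderiv this]
      simp [hP, hD, add_comm]
    have h3 := fderiv_fderiv_comm isOpen_univ hPd.differentiableOn (Set.mem_univ (t, x))
      (1, 0) (0, y)
    rw [h1, h2] at h3
    rw [h3]
    have hdd : DifferentiableAt ℂ (fun p => fderiv ℂ P p (0, y)) (t, x) :=
      (hPd.differentiableOn.fderiv_apply_const isOpen_univ (0, y)).differentiableAt
        Filter.univ_mem
    exact hdd.hasFDerivAt.comp_hasDerivAt t ((hasDerivAt_id t).prodMk (hasDerivAt_const t x))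
  obtain ⟨p, hp⟩ := exists_clm_ker_eq Q
  -- Variation of constants: `(e^{-tx} D)' = e^{-tx} y e^{tx}` lies in `Q`, and `D 0 = 0`.
  have hconst := eq_of_hasDerivAt_zero (f := fun t => p (exp (t • (-x)) * D t)) fun t => by
    have := p.hasFDerivAt.comp_hasDerivAt t ((hasDerivAt_exp_smul' (-x) t).mul (hmix t))
    refine this.congr_deriv ((hp _).2 ?_)
    have e : exp (t • -x) * -x * D t + exp (t • -x) * (y * exp (t • x) + x * D t) =
        exp (-(t • x)) * y * exp (t • x) := by rw [smul_neg]; noncomm_ring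
    rw [e]; exact h t
  have h0 : D 0 = 0 := by
    have : HasFDerivAt (fun z : A => P (0, z)) (fderiv ℂ P (0, x) ∘L ContinuousLinearMap.inr ℂ ℂ A)
        x := (hPd (0, x)).hasFDerivAt.comp x (hasFDerivAt_prodMk_right 0 x)
    have h' : HasFDerivAt (fun z : A => P (0, z)) (0 : A →L[ℂ] A) x := by
      simpa [hP] using hasFDerivAt_const (exp (0 : A)) x
    simpa using congrArg (fun L : A →L[ℂ] A => L y) (this.unique h')
  have h1 : D 1 = fderiv ℂ exp x y := by
    have : HasFDerivAt (fun z : A => P (1, z)) (fderiv ℂ P (1, x) ∘L ContinuousLinearMap.inr ℂ ℂ A)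
        x := (hPd (1, x)).hasFDerivAt.comp x (hasFDerivAt_prodMk_right 1 x)
    have h' : HasFDerivAt (fun z : A => P (1, z)) (fderiv ℂ exp x) x := by
      simpa [hP] using (differentiable_exp x).hasFDerivAt
    simpa using congrArg (fun L : A →L[ℂ] A => L y) (this.unique h')
  rw [← hp]
  simpa [h0, h1] using hconst

end Exponential

/-- A grading `⨁ E_k`, `k ≥ 0`, of a subalgebra of `A`, with finitely many nonzero components and
projections defined on all of `A`. -/
structure LowerGrading (A : Type*) [NormedRing A] [NormedAlgebra ℂ A] where
  E : ℕ → Submodule ℂ A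
  proj : ℕ → A →L[ℂ] A
  proj_mem : ∀ k x, proj k x ∈ E k
  proj_same : ∀ k, ∀ x ∈ E k, proj k x = x
  proj_other : ∀ k l, k ≠ l → ∀ x ∈ E l, proj k x = 0
  mul_mem : ∀ k l, ∀ x ∈ E k, ∀ y ∈ E l, x * y ∈ E (k + l)
  one_mem : (1 : A) ∈ E 0
  exists_bound : ∃ K, ∀ k, K ≤ k → E k = ⊥

/-! ### Degree estimates in a graded algebra -/

namespace LowerGrading

variable {A : Type*} [NormedRing A] [NormedAlgebra ℂ A] (Gr : LowerGrading A)

/-- The sum of the components of degree at least `m`. -/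
def tail (m : ℕ) : Submodule ℂ A := ⨆ k, ⨆ (_ : m ≤ k), Gr.E k

variable {Gr}

theorem E_le_tail {m k : ℕ} (h : m ≤ k) : Gr.E k ≤ Gr.tail m := le_iSup₂_of_le k h le_rfl

theorem tail_anti {m k : ℕ} (h : m ≤ k) : Gr.tail k ≤ Gr.tail m :=
  iSup₂_le fun _ hj => E_le_tail (h.trans hj)

theorem mul_mem_tail {a b : ℕ} {x y : A} (hx : x ∈ Gr.tail a) (hy : y ∈ Gr.tail b) :
    x * y ∈ Gr.tail (a + b) := by
  have h1 : ∀ k, a ≤ k → ∀ x ∈ Gr.E k, x * y ∈ Gr.tail (a + b) := by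
    intro k hk x hx
    have : Gr.tail b ≤ (Gr.tail (a + b)).comap (LinearMap.mulLeft ℂ x) :=
      iSup₂_le fun l hl y hy => E_le_tail (by omega) (Gr.mul_mem k l x hx y hy)
    exact this hy
  have : Gr.tail a ≤ (Gr.tail (a + b)).comap (LinearMap.mulRight ℂ y) :=
    iSup₂_le fun k hk x hx => h1 k hk x hx
  exact this hx

theorem exists_tail_eq_bot (Gr : LowerGrading A) : ∃ K, Gr.tail K = ⊥ := by
  obtain ⟨K, hK⟩ := Gr.exists_bound
  exact ⟨K, le_bot_iff.1 (iSup₂_le fun k hk => (hK k hk).le)⟩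

theorem proj_eq_zero_of_mem_tail {m k : ℕ} (h : k < m) {x : A} (hx : x ∈ Gr.tail m) :
    Gr.proj k x = 0 := by
  have : Gr.tail m ≤ LinearMap.ker (Gr.proj k : A →ₗ[ℂ] A) :=
    iSup₂_le fun l hl x hx => Gr.proj_other k l (by omega) x hx
  exact this hx

theorem sub_proj_mem_tail {m : ℕ} {x : A} (hx : x ∈ Gr.tail m) :
    x - Gr.proj m x ∈ Gr.tail (m + 1) := by
  have : Gr.tail m ≤ (Gr.tail (m + 1)).comap
      (LinearMap.id - (Gr.proj m : A →ₗ[ℂ] A)) := by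
    refine iSup₂_le fun l hl => ?_
    intro x hx
    change x - Gr.proj m x ∈ Gr.tail (m + 1)
    rcases hl.eq_or_lt with rfl | hl
    · rw [Gr.proj_same _ x hx, sub_self]; exact Submodule.zero_mem _
    · rw [Gr.proj_other m l hl.ne x hx, sub_zero]; exact E_le_tail hl hx
  exact this hx

theorem one_mem_tail : (1 : A) ∈ Gr.tail 0 := E_le_tail le_rfl Gr.one_mem

theorem pow_mem_tail {x : A} (hx : x ∈ Gr.tail 1) (k : ℕ) : x ^ k ∈ Gr.tail k := by
  induction k with
  | zero => rw [pow_zero]; exact one_mem_tail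
  | succ k ih => rw [pow_succ]; exact mul_mem_tail ih hx

variable {g : Submodule ℂ A}

/-- The part `⨁_{k ≥ 1} E_k ∩ g` of a subspace `g`. -/
def neg (Gr : LowerGrading A) (g : Submodule ℂ A) : Submodule ℂ A :=
  ⨆ k, ⨆ (_ : 1 ≤ k), Gr.E k ⊓ g

theorem inf_le_neg {k : ℕ} (hk : 1 ≤ k) : Gr.E k ⊓ g ≤ Gr.neg g := le_iSup₂_of_le k hk le_rfl

theorem neg_le_tail : Gr.neg g ≤ Gr.tail 1 :=
  iSup₂_le fun _ hk => inf_le_left.trans (E_le_tail hk)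

theorem proj_mem_of_mem_neg {x : A} (hx : x ∈ Gr.neg g) (k : ℕ) : Gr.proj k x ∈ Gr.E k ⊓ g := by
  have : Gr.neg g ≤ (Gr.E k ⊓ g).comap (Gr.proj k : A →ₗ[ℂ] A) := by
    refine iSup₂_le fun l hl => ?_
    intro x hx
    change Gr.proj k x ∈ Gr.E k ⊓ g
    by_cases h : k = l
    · subst h; rwa [Gr.proj_same k x hx.1]
    · rw [Gr.proj_other k l h x hx.1]; exact Submodule.zero_mem _
  exact this hx

theorem commutator_mem_neg (hg : ∀ x ∈ g, ∀ y ∈ g, x * y - y * x ∈ g) {x y : A}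
    (hx : x ∈ Gr.neg g) (hy : y ∈ Gr.neg g) : x * y - y * x ∈ Gr.neg g := by
  have h1 : ∀ k, 1 ≤ k → ∀ x ∈ Gr.E k ⊓ g, adjointOp x y ∈ Gr.neg g := by
    intro k hk x hx
    have : Gr.neg g ≤ (Gr.neg g).comap (adjointOp x : A →ₗ[ℂ] A) := by
      refine iSup₂_le fun l hl => ?_
      intro y hy
      change x * y - y * x ∈ Gr.neg g
      refine inf_le_neg (k := k + l) (by omega) ⟨Submodule.sub_mem _
        (Gr.mul_mem k l x hx.1 y hy.1) ?_, hg x hx.2 y hy.2⟩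
      rw [add_comm]; exact Gr.mul_mem l k y hy.1 x hx.1
    exact this hy
  have : Gr.neg g ≤ (Gr.neg g).comap ((-adjointOp y : A →L[ℂ] A) : A →ₗ[ℂ] A) := by
    refine iSup₂_le fun k hk => ?_
    intro x hx
    have := h1 k hk x hx
    change -(y * x - x * y) ∈ Gr.neg g
    rwa [neg_sub]
  have h := this hx
  change -(y * x - x * y) ∈ Gr.neg g at h
  rwa [neg_sub] at h

variable [FiniteDimensional ℂ A]

theorem exp_sub_one_mem_tail {x : A} (hx : x ∈ Gr.tail 1) : exp x - 1 ∈ Gr.tail 1 := by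
  have h := (exp_hasSum x).sub (hasSum_ite_eq 0 (1 : A))
  refine mem_of_hasSum h fun k => ?_
  rcases Nat.eq_zero_or_pos k with rfl | hk
  · simp
  · rw [if_neg hk.ne', sub_zero]
    exact Submodule.smul_mem _ _ (tail_anti hk (pow_mem_tail hx k))

theorem exp_mem_tail {x : A} (hx : x ∈ Gr.tail 1) : exp x ∈ Gr.tail 0 := by
  have := Submodule.add_mem _ (tail_anti zero_le_one (exp_sub_one_mem_tail hx)) one_mem_tail
  simpa using this

/-- Termwise in the series: telescoping shows that `(x + y)^{k+1} - x^{k+1}` has degree at least `m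
+ k`, so only the linear term contributes in degree `m`. -/
theorem exp_add_sub_mem_tail {m : ℕ} (hm : 1 ≤ m) {x y : A} (hx : x ∈ Gr.tail 1)
    (hy : y ∈ Gr.tail m) : exp (x + y) - exp x - y ∈ Gr.tail (m + 1) := by
  have hxy : x + y ∈ Gr.tail 1 := Submodule.add_mem _ hx (tail_anti hm hy)
  have hpow : ∀ k : ℕ, (x + y) ^ (k + 1) - x ^ (k + 1) ∈ Gr.tail (m + k) := by
    intro k
    induction k with
    | zero => simpa using hy
    | succ k ih =>
      have e : (x + y) ^ (k + 1 + 1) - x ^ (k + 1 + 1) =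
          ((x + y) ^ (k + 1) - x ^ (k + 1)) * (x + y) + x ^ (k + 1) * y := by
        rw [pow_succ (x + y) (k + 1), pow_succ x (k + 1)]; noncomm_ring
      rw [e]
      have h1 := mul_mem_tail ih hxy
      have h2 := mul_mem_tail (pow_mem_tail hx (k + 1)) hy
      rw [add_assoc] at h1
      rw [add_comm] at h2
      exact Submodule.add_mem _ h1 h2
  have h := ((exp_hasSum (x + y)).sub (exp_hasSum x)).sub (hasSum_ite_eq 1 y)
  refine mem_of_hasSum h fun k => ?_
  rcases k with _ | _ | k
  · simp
  · simp
  · rw [if_neg (by omega), sub_zero, ← smul_sub]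
    exact Submodule.smul_mem _ _ (tail_anti (by omega) (hpow (k + 1)))

/-- The conjugate is `e^{-ad x} y`, a convergent series of iterated commutators, and
finite-dimensional subspaces are closed. -/
theorem conj_exp_mem_neg (hg : ∀ x ∈ g, ∀ y ∈ g, x * y - y * x ∈ g) {x y : A}
    (hx : x ∈ Gr.neg g) (hy : y ∈ Gr.neg g) : exp (-x) * y * exp x ∈ Gr.neg g := by
  rw [← exp_neg_adjointOp_apply]
  have hs : HasSum (fun k => ((k.factorial : ℂ))⁻¹ • ((-(adjointOp x)) ^ k) y)
      (exp (-(adjointOp x)) y) :=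
    (exp_hasSum (-(adjointOp x))).mapL (ContinuousLinearMap.apply ℂ A y)
  refine mem_of_hasSum hs fun k => Submodule.smul_mem _ _ ?_
  induction k with
  | zero => simpa using hy
  | succ k ih =>
    rw [pow_succ']
    have := commutator_mem_neg hg hx ih
    simpa [adjointOp_apply] using Submodule.neg_mem _ this

theorem exp_neg_mul_fderiv_exp_mem_neg (hg : ∀ x ∈ g, ∀ y ∈ g, x * y - y * x ∈ g) {x y : A}
    (hx : x ∈ Gr.neg g) (hy : y ∈ Gr.neg g) : exp (-x) * fderiv ℂ exp x y ∈ Gr.neg g :=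
  exp_neg_mul_fderiv_exp_mem fun t => conj_exp_mem_neg hg (Submodule.smul_mem _ t hx) hy

end LowerGrading
end
end LimitHodge

namespace LimitHodge

noncomputable section

open NormedSpace (exp)
open Set

/-! ### Calculus of the Euler derivations -/

section EulerDeriv

variable {n : ℕ} {r : ℝ} {A : Type*} [NormedRing A] [NormedAlgebra ℂ A]
  {f g : (Fin n → ℂ) → A} {s : Fin n → ℂ}

theorem differentiableAt_of_mem {E : Type*} [NormedAddCommGroup E] [NormedSpace ℂ E]
    {f : (Fin n → ℂ) → E} (hf : DifferentiableOn ℂ f (polydisk n r))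
    (hs : s ∈ polydisk n r) : DifferentiableAt ℂ f s :=
  hf.differentiableAt (isOpen_polydisk.mem_nhds hs)

theorem eulerDeriv_congr {U : Set (Fin n → ℂ)} (hU : IsOpen U) (hs : s ∈ U) (h : EqOn f g U)
    (j : Fin n) : eulerDeriv j f s = eulerDeriv j g s := by
  rw [eulerDeriv, eulerDeriv, pderiv, pderiv,
    (h.eventuallyEq_of_mem (hU.mem_nhds hs)).fderiv_eq]

theorem eulerDeriv_add (hf : DifferentiableAt ℂ f s) (hg : DifferentiableAt ℂ g s) (j : Fin n) :
    eulerDeriv j (fun s => f s + g s) s = eulerDeriv j f s + eulerDeriv j g s := by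
  simp [eulerDeriv, pderiv, fderiv_fun_add hf hg]

theorem eulerDeriv_sub (hf : DifferentiableAt ℂ f s) (hg : DifferentiableAt ℂ g s) (j : Fin n) :
    eulerDeriv j (fun s => f s - g s) s = eulerDeriv j f s - eulerDeriv j g s := by
  simp [eulerDeriv, pderiv, fderiv_fun_sub hf hg, smul_sub]

theorem eulerDeriv_mul (hf : DifferentiableAt ℂ f s) (hg : DifferentiableAt ℂ g s) (j : Fin n) :
    eulerDeriv j (fun s => f s * g s) s = eulerDeriv j f s * g s + f s * eulerDeriv j g s := by
  simp [eulerDeriv, pderiv, fderiv_fun_mul' hf hg, add_comm]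

theorem eulerDeriv_const (a : A) (j : Fin n) : eulerDeriv j (fun _ => a) s = 0 := by
  simp [eulerDeriv, pderiv]

theorem eulerDeriv_const_mul (a : A) (hf : DifferentiableAt ℂ f s) (j : Fin n) :
    eulerDeriv j (fun s => a * f s) s = a * eulerDeriv j f s := by
  rw [eulerDeriv_mul (differentiableAt_const a) hf, eulerDeriv_const, zero_mul, zero_add]

theorem eulerDeriv_clm (p : A →L[ℂ] A) (hf : DifferentiableAt ℂ f s) (j : Fin n) :
    eulerDeriv j (fun s => p (f s)) s = p (eulerDeriv j f s) := by
  rw [eulerDeriv, eulerDeriv, pderiv, pderiv, map_smul]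
  have := (p.hasFDerivAt.comp s hf.hasFDerivAt).fderiv
  rw [show (fun s => p (f s)) = p ∘ f from rfl, this]
  rfl

variable [FiniteDimensional ℂ A]

theorem differentiableOn_eulerDeriv (hf : DifferentiableOn ℂ f (polydisk n r)) (j : Fin n) :
    DifferentiableOn ℂ (eulerDeriv j f) (polydisk n r) :=
  DifferentiableOn.smul (by fun_prop) (hf.fderiv_apply_const isOpen_polydisk _)

theorem eulerDeriv_comm (hf : DifferentiableOn ℂ f (polydisk n r)) (hs : s ∈ polydisk n r)
    (i j : Fin n) : eulerDeriv i (eulerDeriv j f) s = eulerDeriv j (eulerDeriv i f) s := by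
  rcases eq_or_ne i j with rfl | hij
  · rfl
  have key : ∀ i j : Fin n, i ≠ j → eulerDeriv i (eulerDeriv j f) s =
      (s i * s j) • pderiv i (pderiv j f) s := by
    intro i j hij
    have h1 : DifferentiableAt ℂ (pderiv j f) s :=
      differentiableAt_of_mem (hf.fderiv_apply_const isOpen_polydisk (Pi.single j 1)) hs
    have h2 : HasFDerivAt (fun s : Fin n → ℂ => s j)
      (ContinuousLinearMap.proj (R := ℂ) (φ := fun _ : Fin n => ℂ) j) s := hasFDerivAt_apply j s
    have h3 := (h2.fun_smul h1.hasFDerivAt).fderiv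
    change s i • (fderiv ℂ (fun s => s j • pderiv j f s) s) (Pi.single i 1) = _
    rw [h3]
    simp [hij.symm, smul_smul, pderiv]
  rw [key i j hij, key j i hij.symm, mul_comm]
  congr 1
  exact fderiv_fderiv_comm isOpen_polydisk hf hs _ _

theorem eulerDeriv_mem {Q : Submodule ℂ A} {U : Set (Fin n → ℂ)} (hU : IsOpen U) (hs : s ∈ U)
    (hf : DifferentiableAt ℂ f s) (h : ∀ s ∈ U, f s ∈ Q) (j : Fin n) : eulerDeriv j f s ∈ Q := by
  obtain ⟨p, hp⟩ := exists_clm_ker_eq Q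
  rw [← hp, ← eulerDeriv_clm p hf, eulerDeriv_congr hU hs (g := fun _ => 0)
    (fun s hs => (hp _).2 (h s hs)), eulerDeriv_const]

theorem mem_of_eulerDeriv_mem {Q : Submodule ℂ A} (hf : DifferentiableOn ℂ f (polydisk n r))
    (h0 : f 0 ∈ Q) (h : ∀ s ∈ puncturedPolydisk n r, ∀ j, eulerDeriv j f s ∈ Q) :
    ∀ s ∈ polydisk n r, f s ∈ Q := by
  obtain ⟨p, hp⟩ := exists_clm_ker_eq Q
  intro s hs
  rw [← hp]
  have := eqOn_of_eulerDeriv_eq_zero (f := fun s => p (f s))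
    (p.differentiable.comp_differentiableOn hf) (fun s hs j => by
      rw [eulerDeriv_clm p (differentiableAt_of_mem hf hs.1)]
      exact (hp _).2 (h s hs j)) hs
  exact this.trans ((hp _).2 h0)

theorem eqOn_of_eulerDeriv_eq (hf : DifferentiableOn ℂ f (polydisk n r))
    (hg : DifferentiableOn ℂ g (polydisk n r)) (h0 : f 0 = g 0)
    (h : ∀ s ∈ puncturedPolydisk n r, ∀ j, eulerDeriv j f s = eulerDeriv j g s) :
    EqOn f g (polydisk n r) := by
  intro s hs
  have := mem_of_eulerDeriv_mem (Q := ⊥) (f := fun s => f s - g s) (hf.sub hg) (by simp [h0])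
    (fun s hs j => by
      rw [eulerDeriv_sub (differentiableAt_of_mem hf hs.1) (differentiableAt_of_mem hg hs.1),
        h s hs j, sub_self]
      exact Submodule.zero_mem _) s hs
  exact sub_eq_zero.1 this

theorem differentiableOn_exp {U : Set (Fin n → ℂ)} (hf : DifferentiableOn ℂ f U) :
    DifferentiableOn ℂ (fun s => exp (f s)) U :=
  differentiable_exp.comp_differentiableOn hf

end EulerDeriv

/-! ### Gauge transforms of the connection -/

section LogForm

variable {n : ℕ} {r : ℝ} {A : Type*} [NormedRing A] [NormedAlgebra ℂ A] [FiniteDimensional ℂ A]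
  {Gr : LowerGrading A} {g : Submodule ℂ A} {M : Fin n → A}

/-- The coefficient of `ds_j / s_j` in `e^{-G} (∂ + ∑ M_j ds_j / s_j) e^G`. -/
def logForm (M : Fin n → A) (G : (Fin n → ℂ) → A) (j : Fin n) (s : Fin n → ℂ) : A :=
  exp (-(G s)) * (eulerDeriv j (fun s => exp (G s)) s + M j * exp (G s))

/-- The factors lie only in the associative algebra, but the form is a sum of a logarithmic
derivative of `exp` and a conjugate of `M j`, both of which stay in the Lie algebra. -/
theorem logForm_mem_neg (hg : ∀ x ∈ g, ∀ y ∈ g, x * y - y * x ∈ g)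
    (hM : ∀ j, M j ∈ Gr.E 1 ⊓ g) {G : (Fin n → ℂ) → A} (hG : DifferentiableOn ℂ G (polydisk n r))
    (hGn : ∀ s ∈ polydisk n r, G s ∈ Gr.neg g) {s : Fin n → ℂ} (hs : s ∈ polydisk n r)
    (j : Fin n) : logForm M G j s ∈ Gr.neg g := by
  have hGs := differentiableAt_of_mem hG hs
  have e : eulerDeriv j (fun s => exp (G s)) s = fderiv ℂ exp (G s) (eulerDeriv j G s) := by
    have := ((differentiable_exp (G s)).hasFDerivAt.comp s hGs.hasFDerivAt).fderiv
    rw [eulerDeriv, eulerDeriv, pderiv, pderiv, map_smul,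
      show (fun s => exp (G s)) = exp ∘ G from rfl, this]
    rfl
  rw [logForm, mul_add, e, ← mul_assoc]
  exact Submodule.add_mem _ (LowerGrading.exp_neg_mul_fderiv_exp_mem_neg hg (hGn s hs)
    (eulerDeriv_mem isOpen_polydisk hs hGs hGn j))
    (LowerGrading.conj_exp_mem_neg hg (hGn s hs) (LowerGrading.inf_le_neg le_rfl (hM j)))

/-- `u` intertwines the connection forms `∑ M_j ds_j / s_j` and `∑ h_j ds_j / s_j`. -/
def Intertwines (r : ℝ) (M : Fin n → A) (h : Fin n → (Fin n → ℂ) → A) (u : (Fin n → ℂ) → A) :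
    Prop :=
  ∀ s ∈ puncturedPolydisk n r, ∀ j, eulerDeriv j u s + M j * u s = u s * h j s

theorem intertwines_exp {G : (Fin n → ℂ) → A} {h : Fin n → (Fin n → ℂ) → A}
    (hG : ∀ s ∈ puncturedPolydisk n r, ∀ j, logForm M G j s = h j s) :
    Intertwines r M h fun s => exp (G s) := fun s hs j => by
  rw [← hG s hs j, logForm, ← mul_assoc, exp_mul_exp_neg, one_mul]

theorem logForm_eq_of_intertwines {G : (Fin n → ℂ) → A} {h : Fin n → (Fin n → ℂ) → A}
    {u : (Fin n → ℂ) → A} (hu : Intertwines r M h u) (huG : ∀ s ∈ polydisk n r, u s = exp (G s))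
    {s : Fin n → ℂ} (hs : s ∈ puncturedPolydisk n r) (j : Fin n) : logForm M G j s = h j s := by
  have := hu s hs j
  rw [eulerDeriv_congr isOpen_polydisk hs.1 huG, huG s hs.1] at this
  rw [logForm, this, ← mul_assoc, exp_neg_mul_exp, one_mul]

/-- If `u` is `e^G + x` up to terms of degree greater than `m`, where `x` has degree at least `m`,
then the forms obtained from `u` and `G` differ by the derivative of `x`, up to terms of degree
greater than `m`. -/
theorem logForm_add_eulerDeriv_sub_mem_tail (hM : ∀ j, M j ∈ Gr.tail 1)
    {G u x : (Fin n → ℂ) → A} {h : Fin n → (Fin n → ℂ) → A} {m : ℕ} (hu : Intertwines r M h u)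
    (hud : DifferentiableOn ℂ u (polydisk n r)) (hGd : DifferentiableOn ℂ G (polydisk n r))
    (hxd : DifferentiableOn ℂ x (polydisk n r))
    (hG : ∀ s ∈ polydisk n r, G s ∈ Gr.tail 1) (hx : ∀ s ∈ polydisk n r, x s ∈ Gr.tail m)
    (hux : ∀ s ∈ polydisk n r, u s - exp (G s) - x s ∈ Gr.tail (m + 1))
    (hh : ∀ s ∈ puncturedPolydisk n r, ∀ j, h j s ∈ Gr.tail 1)
    {s : Fin n → ℂ} (hs : s ∈ puncturedPolydisk n r) (j : Fin n) :
    logForm M G j s + eulerDeriv j x s - h j s ∈ Gr.tail (m + 1) := by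
  have hed := differentiableOn_exp hGd
  have hsub : DifferentiableOn ℂ (fun s => u s - exp (G s)) (polydisk n r) := hud.sub hed
  have hρ : eulerDeriv j u s - eulerDeriv j (fun s => exp (G s)) s - eulerDeriv j x s ∈
      Gr.tail (m + 1) := by
    have := eulerDeriv_mem (f := fun s => u s - exp (G s) - x s) isOpen_polydisk hs.1
      (differentiableAt_of_mem (hsub.sub hxd) hs.1) hux j
    rwa [eulerDeriv_sub (differentiableAt_of_mem hsub hs.1) (differentiableAt_of_mem hxd hs.1),
      eulerDeriv_sub (differentiableAt_of_mem hud hs.1) (differentiableAt_of_mem hed hs.1)] at this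
  have hd : u s - exp (G s) ∈ Gr.tail m := by
    have := Submodule.add_mem _ (LowerGrading.tail_anti (Nat.le_succ m) (hux s hs.1)) (hx s hs.1)
    simpa using this
  have hGn : exp (-(G s)) ∈ Gr.tail 0 :=
    LowerGrading.exp_mem_tail (Submodule.neg_mem _ (hG s hs.1))
  have hGn1 : exp (-(G s)) - 1 ∈ Gr.tail 1 :=
    LowerGrading.exp_sub_one_mem_tail (Submodule.neg_mem _ (hG s hs.1))
  have hθx : eulerDeriv j x s ∈ Gr.tail m :=
    eulerDeriv_mem isOpen_polydisk hs.1 (differentiableAt_of_mem hxd hs.1) hx j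
  have t1 := LowerGrading.mul_mem_tail hGn1 hθx
  have t2 := LowerGrading.mul_mem_tail hGn (LowerGrading.mul_mem_tail (hM j) hd)
  have t3 := LowerGrading.mul_mem_tail hGn (LowerGrading.mul_mem_tail hd (hh s hs j))
  have t4 := LowerGrading.mul_mem_tail hGn hρ
  rw [add_comm 1 m] at t1
  rw [zero_add, add_comm 1 m] at t2
  rw [zero_add] at t3 t4
  -- The difference is arranged so that every term either pairs a factor of degree at least `m` with
  -- one of degree at least 1, or contains the derivative of the remainder.
  have e : logForm M G j s + eulerDeriv j x s - h j s =
      exp (-(G s)) * ((u s - exp (G s)) * h j s) - exp (-(G s)) * (M j * (u s - exp (G s))) -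
        exp (-(G s)) * (eulerDeriv j u s - eulerDeriv j (fun s => exp (G s)) s - eulerDeriv j x s)
        - (exp (-(G s)) - 1) * eulerDeriv j x s := by
    have h1 : h j s = exp (-(G s)) * (exp (G s) * h j s) := by
      rw [← mul_assoc, exp_neg_mul_exp, one_mul]
    have h2 : eulerDeriv j u s = u s * h j s - M j * u s := eq_sub_of_add_eq (hu s hs j)
    rw [logForm, h2]
    nth_rewrite 1 [h1]
    noncomm_ring
  rw [e]
  exact Submodule.sub_mem _ (Submodule.sub_mem _ (Submodule.sub_mem _ t3 t2) t4) t1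

/-- The form of a connection that is intertwined with a flat connection with closed form is again
flat. -/
theorem commute_of_intertwines (hMc : ∀ i j, M i * M j = M j * M i) {u v : (Fin n → ℂ) → A}
    {h : Fin n → (Fin n → ℂ) → A} (hud : DifferentiableOn ℂ u (polydisk n r))
    (hhd : ∀ j, DifferentiableOn ℂ (h j) (polydisk n r))
    (hhc : ∀ s ∈ puncturedPolydisk n r, ∀ i j, eulerDeriv i (h j) s = eulerDeriv j (h i) s)
    (hu : Intertwines r M h u) (hv : ∀ s, v s * u s = 1)
    {s : Fin n → ℂ} (hs : s ∈ puncturedPolydisk n r) (i j : Fin n) :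
    h i s * h j s = h j s * h i s := by
  have hu' : ∀ j, ∀ s ∈ puncturedPolydisk n r, eulerDeriv j u s = u s * h j s - M j * u s :=
    fun j s hs => eq_sub_of_add_eq (hu s hs j)
  have hus := differentiableAt_of_mem hud hs.1
  have key : ∀ i j, eulerDeriv i (eulerDeriv j u) s =
      (u s * h i s - M i * u s) * h j s + u s * eulerDeriv i (h j) s -
        M j * (u s * h i s - M i * u s) := by
    intro i j
    have hhs := differentiableAt_of_mem (hhd j) hs.1
    rw [eulerDeriv_congr isOpen_puncturedPolydisk hs (hu' j),
      eulerDeriv_sub (hus.fun_mul hhs) (hus.const_mul (M j)), eulerDeriv_mul hus hhs,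
      eulerDeriv_const_mul _ hus, hu' i s hs]
  -- Equating the two mixed derivatives, the terms `u θ_i h_j` and `M_j M_i u` cancel and the cross
  -- terms are symmetric; only `u [h_i, h_j] = 0` is left.
  have h1 := eulerDeriv_comm hud hs.1 i j
  rw [key, key, hhc s hs i j] at h1
  have h2 : u s * (h i s * h j s) = u s * (h j s * h i s) := by
    have h3 : (M i * M j) * u s = (M j * M i) * u s := by rw [hMc]
    have e1 : u s * (h i s * h j s) = ((u s * h i s - M i * u s) * h j s +
        u s * eulerDeriv j (h i) s - M j * (u s * h i s - M i * u s)) +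
        M i * u s * h j s - u s * eulerDeriv j (h i) s + M j * u s * h i s - M j * M i * u s := by
      noncomm_ring
    rw [e1, h1, ← h3]
    noncomm_ring
  calc h i s * h j s = v s * (u s * (h i s * h j s)) := by rw [← mul_assoc (v s), hv, one_mul]
    _ = v s * (u s * (h j s * h i s)) := by rw [h2]
    _ = _ := by rw [← mul_assoc (v s), hv, one_mul]

end LogForm

end
end LimitHodge

namespace LimitHodge

noncomputable section

open NormedSpace (exp)
open Set

namespace LowerGrading

variable {A : Type*} [NormedRing A] [NormedAlgebra ℂ A] (Gr : LowerGrading A)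

/-- The sum of the components of degrees `1, …, k - 1`. -/
def trunc (k : ℕ) (x : A) : A := ∑ i ∈ Finset.Ico 1 k, Gr.proj i x

variable {Gr}

theorem proj_trunc (k : ℕ) (x : A) : Gr.proj k (Gr.trunc k x) = 0 := by
  rw [trunc, map_sum]
  exact Finset.sum_eq_zero fun i hi =>
    Gr.proj_other k i (Finset.mem_Ico.1 hi).2.ne' _ (Gr.proj_mem i x)

theorem sub_trunc_mem_tail {x : A} (hx : x ∈ Gr.tail 1) {k : ℕ} (hk : 1 ≤ k) :
    x - Gr.trunc k x ∈ Gr.tail k := by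
  induction k, hk using Nat.le_induction with
  | base => simpa [trunc] using hx
  | succ k hk ih =>
    have h1 := sub_proj_mem_tail ih
    rwa [map_sub, proj_trunc, sub_zero, sub_sub, trunc, ← Finset.sum_Ico_succ_top hk] at h1

theorem proj_sub_trunc (x : A) {k : ℕ} : Gr.proj k (x - Gr.trunc k x) = Gr.proj k x := by
  rw [map_sub, proj_trunc, sub_zero]

theorem trunc_mem_neg {g : Submodule ℂ A} {x : A} (hx : x ∈ Gr.neg g) (k : ℕ) :
    Gr.trunc k x ∈ Gr.neg g :=
  Submodule.sum_mem _ fun i hi => inf_le_neg (Finset.mem_Ico.1 hi).1 (proj_mem_of_mem_neg hx i)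

end LowerGrading

/-! ### Uniqueness and construction of solutions -/

section Solutions

variable {n : ℕ} {r : ℝ} {A : Type*} [NormedRing A] [NormedAlgebra ℂ A]
  {Gr : LowerGrading A} {g : Submodule ℂ A} {M : Fin n → A}

/-- The coefficient of `ds_j / s_j` in `∑ M_j ds_j / s_j + ∂γ`. -/
def higgsForm (M : Fin n → A) (γ : (Fin n → ℂ) → A) (j : Fin n) (s : Fin n → ℂ) : A :=
  M j + eulerDeriv j γ s

theorem higgsForm_zero (γ : (Fin n → ℂ) → A) (j : Fin n) : higgsForm M γ j 0 = M j := by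
  simp [higgsForm, eulerDeriv]

variable [FiniteDimensional ℂ A]

/-- Comparing `e^Γ` with `e^0` at `m = 1` gives the form as `M_j + θ_jΓ` up to degree 2 and beyond;
being homogeneous of degree 1, it equals its degree 1 part. -/
theorem logForm_eq_higgsForm (hM : ∀ j, M j ∈ Gr.E 1 ⊓ g) {Γ : (Fin n → ℂ) → A}
    (hΓ : DifferentiableOn ℂ Γ (polydisk n r)) (hΓn : ∀ s ∈ polydisk n r, Γ s ∈ Gr.neg g)
    (hE : ∀ s ∈ puncturedPolydisk n r, ∀ j, logForm M Γ j s ∈ Gr.E 1)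
    {s : Fin n → ℂ} (hs : s ∈ puncturedPolydisk n r) (j : Fin n) :
    logForm M Γ j s = higgsForm M (fun s => Gr.proj 1 (Γ s)) j s := by
  have h := logForm_add_eulerDeriv_sub_mem_tail (Gr := Gr) (m := 1)
    (fun j => LowerGrading.E_le_tail le_rfl (hM j).1) (G := fun _ => 0) (x := Γ)
    (intertwines_exp (r := r) (h := logForm M Γ) fun _ _ _ => rfl) (differentiableOn_exp hΓ)
    (differentiableOn_const 0) hΓ (fun _ _ => Submodule.zero_mem _)
    (fun s hs => LowerGrading.neg_le_tail (hΓn s hs))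
    (fun s hs => by
      simpa using LowerGrading.exp_add_sub_mem_tail le_rfl (Submodule.zero_mem (Gr.tail 1))
        (LowerGrading.neg_le_tail (hΓn s hs)))
    (fun s hs j => LowerGrading.E_le_tail le_rfl (hE s hs j)) hs j
  have h1 := LowerGrading.proj_eq_zero_of_mem_tail (k := 1) (by norm_num) h
  have h0 : logForm M (fun _ => 0) j s = M j := by simp [logForm, eulerDeriv_const]
  rw [h0, map_sub, map_add, Gr.proj_same 1 _ (hE s hs j), Gr.proj_same 1 _ (hM j).1,
    sub_eq_zero] at h1
  rw [higgsForm, eulerDeriv_clm _ (differentiableAt_of_mem hΓ hs.1), h1]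

theorem intertwines_of_solution (hM : ∀ j, M j ∈ Gr.E 1 ⊓ g) {Γ : (Fin n → ℂ) → A}
    (hΓ : DifferentiableOn ℂ Γ (polydisk n r)) (hΓn : ∀ s ∈ polydisk n r, Γ s ∈ Gr.neg g)
    (hE : ∀ s ∈ puncturedPolydisk n r, ∀ j, logForm M Γ j s ∈ Gr.E 1) :
    Intertwines r M (higgsForm M fun s => Gr.proj 1 (Γ s)) fun s => exp (Γ s) :=
  intertwines_exp fun _ hs j => logForm_eq_higgsForm hM hΓ hΓn hE hs j

/-- The same comparison at `m = k`, with `G` the truncation of `Γ` and `x` the rest of it: for `k ≥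
2` the form of `Γ` has no part of degree `k`. -/
theorem eulerDeriv_proj_eq (hM : ∀ j, M j ∈ Gr.E 1 ⊓ g) {Γ : (Fin n → ℂ) → A}
    (hΓ : DifferentiableOn ℂ Γ (polydisk n r)) (hΓn : ∀ s ∈ polydisk n r, Γ s ∈ Gr.neg g)
    (hE : ∀ s ∈ puncturedPolydisk n r, ∀ j, logForm M Γ j s ∈ Gr.E 1) {k : ℕ} (hk : 2 ≤ k)
    {s : Fin n → ℂ} (hs : s ∈ puncturedPolydisk n r) (j : Fin n) :
    eulerDeriv j (fun s => Gr.proj k (Γ s)) s =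
      -Gr.proj k (logForm M (fun s => Gr.trunc k (Γ s)) j s) := by
  have htd : DifferentiableOn ℂ (fun s => Gr.trunc k (Γ s)) (polydisk n r) :=
    DifferentiableOn.fun_sum fun i _ => (Gr.proj i).differentiable.comp_differentiableOn hΓ
  have htn : ∀ s ∈ polydisk n r, Gr.trunc k (Γ s) ∈ Gr.tail 1 := fun s hs =>
    LowerGrading.neg_le_tail (LowerGrading.trunc_mem_neg (hΓn s hs) k)
  have hxt : ∀ s ∈ polydisk n r, Γ s - Gr.trunc k (Γ s) ∈ Gr.tail k := fun s hs =>
    LowerGrading.sub_trunc_mem_tail (LowerGrading.neg_le_tail (hΓn s hs)) (by omega)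
  have h := logForm_add_eulerDeriv_sub_mem_tail (Gr := Gr) (m := k)
    (fun j => LowerGrading.E_le_tail le_rfl (hM j).1) (G := fun s => Gr.trunc k (Γ s))
    (x := fun s => Γ s - Gr.trunc k (Γ s))
    (intertwines_exp (r := r) (h := logForm M Γ) fun _ _ _ => rfl) (differentiableOn_exp hΓ)
    htd (hΓ.sub htd) htn hxt
    (fun s hs => by
      simpa using LowerGrading.exp_add_sub_mem_tail (by omega) (htn s hs) (hxt s hs))
    (fun s hs j => LowerGrading.E_le_tail le_rfl (hE s hs j)) hs j
  have h1 := LowerGrading.proj_eq_zero_of_mem_tail (k := k) (Nat.lt_succ_self k) h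
  rw [map_sub, map_add, Gr.proj_other k 1 (by omega) _ (hE s hs j), sub_zero,
    ← eulerDeriv_clm (f := fun s => Γ s - Gr.trunc k (Γ s)) _
      (differentiableAt_of_mem (hΓ.sub htd) hs.1)] at h1
  simp only [LowerGrading.proj_sub_trunc] at h1
  exact eq_neg_of_add_eq_zero_right h1

/-- Strong induction on the degree: the derivative of each component depends only on the components
before it. -/
theorem proj_eqOn_of_solution (hM : ∀ j, M j ∈ Gr.E 1 ⊓ g) {Γ Γ' : (Fin n → ℂ) → A}
    (hΓ : DifferentiableOn ℂ Γ (polydisk n r)) (hΓn : ∀ s ∈ polydisk n r, Γ s ∈ Gr.neg g)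
    (hE : ∀ s ∈ puncturedPolydisk n r, ∀ j, logForm M Γ j s ∈ Gr.E 1) (hΓ0 : Γ 0 = 0)
    (hΓ' : DifferentiableOn ℂ Γ' (polydisk n r)) (hΓn' : ∀ s ∈ polydisk n r, Γ' s ∈ Gr.neg g)
    (hE' : ∀ s ∈ puncturedPolydisk n r, ∀ j, logForm M Γ' j s ∈ Gr.E 1) (hΓ0' : Γ' 0 = 0)
    (h1 : ∀ s ∈ polydisk n r, Gr.proj 1 (Γ s) = Gr.proj 1 (Γ' s)) :
    EqOn Γ Γ' (polydisk n r) := by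
  have key : ∀ k, 1 ≤ k → ∀ s ∈ polydisk n r, Gr.proj k (Γ s) = Gr.proj k (Γ' s) := by
    intro k
    induction k using Nat.strong_induction_on with
    | _ k ih =>
      intro hk
      rcases hk.eq_or_lt with rfl | hk
      · exact h1
      have hpd : ∀ {F : (Fin n → ℂ) → A}, DifferentiableOn ℂ F (polydisk n r) →
          DifferentiableOn ℂ (fun s => Gr.proj k (F s)) (polydisk n r) := fun hF =>
        (Gr.proj k).differentiable.comp_differentiableOn hF
      refine eqOn_of_eulerDeriv_eq (hpd hΓ) (hpd hΓ') (by simp only [hΓ0, hΓ0']) fun s hs j => ?_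
      rw [eulerDeriv_proj_eq hM hΓ hΓn hE hk hs, eulerDeriv_proj_eq hM hΓ' hΓn' hE' hk hs]
      have ht : EqOn (fun s => Gr.trunc k (Γ s)) (fun s => Gr.trunc k (Γ' s)) (polydisk n r) :=
        fun s hs => Finset.sum_congr rfl fun i hi =>
          ih i (Finset.mem_Ico.1 hi).2 (Finset.mem_Ico.1 hi).1 s hs
      have hexp : EqOn (fun s => exp (Gr.trunc k (Γ s))) (fun s => exp (Gr.trunc k (Γ' s)))
        (polydisk n r) := fun s hs => congrArg exp (ht hs)
      have hts : Gr.trunc k (Γ s) = Gr.trunc k (Γ' s) := ht hs.1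
      rw [logForm, logForm, eulerDeriv_congr isOpen_polydisk hs.1 hexp, hts]
  obtain ⟨K, hK⟩ := Gr.exists_tail_eq_bot
  intro s hs
  have ht : ∀ {F : (Fin n → ℂ) → A}, (∀ s ∈ polydisk n r, F s ∈ Gr.neg g) →
      F s = Gr.trunc (K + 1) (F s) := by
    intro F hF
    have := LowerGrading.tail_anti (Nat.le_succ K) (LowerGrading.sub_trunc_mem_tail
      (LowerGrading.neg_le_tail (hF s hs)) (Nat.succ_pos K))
    rw [hK, Submodule.mem_bot, sub_eq_zero] at this
    exact this
  rw [ht hΓn, ht hΓn']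
  exact Finset.sum_congr rfl fun i hi => key i (Finset.mem_Ico.1 hi).1 s hs

theorem differentiableOn_higgsForm {γ : (Fin n → ℂ) → A}
    (hγ : DifferentiableOn ℂ γ (polydisk n r)) (j : Fin n) :
    DifferentiableOn ℂ (higgsForm M γ j) (polydisk n r) :=
  (differentiableOn_const (M j)).add (differentiableOn_eulerDeriv hγ j)

theorem eulerDeriv_higgsForm_comm {γ : (Fin n → ℂ) → A}
    (hγ : DifferentiableOn ℂ γ (polydisk n r)) {s : Fin n → ℂ} (hs : s ∈ polydisk n r)
    (i j : Fin n) : eulerDeriv i (higgsForm M γ j) s = eulerDeriv j (higgsForm M γ i) s := by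
  have : ∀ i j, eulerDeriv i (higgsForm M γ j) s = eulerDeriv i (eulerDeriv j γ) s := by
    intro i j
    refine (eulerDeriv_add (f := fun _ => M j) (differentiableAt_const _)
      (differentiableAt_of_mem (differentiableOn_eulerDeriv hγ j) hs) i).trans ?_
    rw [eulerDeriv_const, zero_add]
  rw [this, this, eulerDeriv_comm hγ hs]

theorem higgsForm_mem (hM : ∀ j, M j ∈ Gr.E 1 ⊓ g) {γ : (Fin n → ℂ) → A}
    (hγ : DifferentiableOn ℂ γ (polydisk n r)) (hγE : ∀ s ∈ polydisk n r, γ s ∈ Gr.E 1 ⊓ g)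
    {s : Fin n → ℂ} (hs : s ∈ polydisk n r) (j : Fin n) : higgsForm M γ j s ∈ Gr.E 1 ⊓ g :=
  Submodule.add_mem _ (hM j) (eulerDeriv_mem isOpen_polydisk hs (differentiableAt_of_mem hγ hs)
    hγE j)

/-- A flat connection `d + ∑ h_j ds_j / s_j` of degree one, with closed form and residues `M_j` at
the origin, is intertwined with its residue by a unipotent holomorphic function. -/
theorem exists_intertwines (Gr : LowerGrading A) (hME : ∀ j, M j ∈ Gr.E 1)
    (hMc : ∀ i j, M i * M j = M j * M i) {h : Fin n → (Fin n → ℂ) → A}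
    (hhd : ∀ j, DifferentiableOn ℂ (h j) (polydisk n r)) (hh0 : ∀ j, h j 0 = M j)
    (hhE : ∀ s ∈ polydisk n r, ∀ j, h j s ∈ Gr.E 1)
    (hhc : ∀ s ∈ puncturedPolydisk n r, ∀ i j, eulerDeriv i (h j) s = eulerDeriv j (h i) s)
    (hflat : ∀ s ∈ puncturedPolydisk n r, ∀ i j, h i s * h j s = h j s * h i s) :
    ∃ u : (Fin n → ℂ) → A, DifferentiableOn ℂ u (polydisk n r) ∧ u 0 = 1 ∧
      (∀ s ∈ polydisk n r, u s - 1 ∈ Gr.tail 1) ∧ Intertwines r M h u := by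
  -- Here `u` is the homogeneous term `u_k`, `w` the preceding one (zero for `k = 0`) and `S` the
  -- sum of `u_0, …, u_k`. Commutation of `M j` with `u 0` makes the next form to be integrated
  -- vanish at the origin.
  have key : ∀ k : ℕ, ∃ S u w : (Fin n → ℂ) → A, DifferentiableOn ℂ S (polydisk n r) ∧
      DifferentiableOn ℂ u (polydisk n r) ∧ (∀ s ∈ polydisk n r, u s ∈ Gr.E k) ∧
      (∀ s ∈ polydisk n r, S s - 1 ∈ Gr.tail 1) ∧ S 0 = 1 ∧ (∀ j, M j * u 0 = u 0 * M j) ∧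
      (∀ s ∈ puncturedPolydisk n r, ∀ j, eulerDeriv j u s = w s * h j s - M j * w s) ∧
      ∀ s ∈ puncturedPolydisk n r, ∀ j,
        eulerDeriv j S s = (S s - u s) * h j s - M j * (S s - u s) := by
    intro k
    induction k with
    | zero =>
      exact ⟨fun _ => 1, fun _ => 1, fun _ => 0, differentiableOn_const _,
        differentiableOn_const _, fun _ _ => Gr.one_mem, fun _ _ => by simp, rfl,
        fun j => by simp, fun s _ j => by simp [eulerDeriv_const],
        fun s _ j => by simp [eulerDeriv_const]⟩
    | succ k ih =>
      obtain ⟨S, u, w, hS, hu, huE, hS1, hS0, hu0, hθu, hθS⟩ := ih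
      have hb : ∀ j, DifferentiableOn ℂ (fun s => u s * h j s - M j * u s) (polydisk n r) :=
        fun j => (hu.fun_mul (hhd j)).fun_sub (hu.const_mul (M j))
      obtain ⟨f, hf, hf0, hfb⟩ := exists_log_primitive (r := r)
        (b := fun j s => u s * h j s - M j * u s) hb
        (fun j => by simp only [hh0, hu0, sub_self]) fun s hs i j => by
          have hus := differentiableAt_of_mem hu hs.1
          have e : ∀ i j, eulerDeriv i (fun s => u s * h j s - M j * u s) s =
              (w s * h i s - M i * w s) * h j s + u s * eulerDeriv i (h j) s -
                M j * (w s * h i s - M i * w s) := fun i j => by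
            have hhs := differentiableAt_of_mem (hhd j) hs.1
            rw [eulerDeriv_sub (hus.fun_mul hhs) (hus.const_mul (M j)), eulerDeriv_mul hus hhs,
              eulerDeriv_const_mul _ hus, hθu s hs]
          have h3 : w s * (h i s * h j s) = w s * (h j s * h i s) := by rw [hflat s hs]
          have h4 : M i * M j * w s = M j * M i * w s := by rw [hMc]
          rw [e, e, hhc s hs i j, ← sub_eq_zero]
          calc _ = (w s * (h i s * h j s) - w s * (h j s * h i s)) -
                (M i * M j * w s - M j * M i * w s) := by noncomm_ring
            _ = 0 := by rw [h3, h4, sub_self, sub_self, sub_self]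
      -- The primitive need not be homogeneous, but its derivatives have degree `k + 1`, so
      -- projecting to that degree leaves them unchanged.
      have hpd : DifferentiableOn ℂ (fun s => Gr.proj (k + 1) (f s)) (polydisk n r) :=
        (Gr.proj (k + 1)).differentiable.comp_differentiableOn hf
      have hθ : ∀ s ∈ puncturedPolydisk n r, ∀ j,
          eulerDeriv j (fun s => Gr.proj (k + 1) (f s)) s = u s * h j s - M j * u s := by
        intro s hs j
        rw [eulerDeriv_clm _ (differentiableAt_of_mem hf hs.1), hfb s hs, Gr.proj_same]
        refine Submodule.sub_mem _ (Gr.mul_mem k 1 _ (huE s hs.1) _ (hhE s hs.1 j)) ?_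
        rw [add_comm]
        exact Gr.mul_mem 1 k _ (hME j) _ (huE s hs.1)
      refine ⟨fun s => S s + Gr.proj (k + 1) (f s), fun s => Gr.proj (k + 1) (f s), u,
        hS.add hpd, hpd, fun s _ => Gr.proj_mem _ _, fun s hs => ?_, ?_, fun j => ?_, hθ,
        fun s hs j => ?_⟩
      · rw [add_sub_right_comm]
        exact Submodule.add_mem _ (hS1 s hs)
          (LowerGrading.E_le_tail (by omega) (Gr.proj_mem (k + 1) (f s)))
      · simp only [hf0, map_zero, add_zero, hS0]
      · simp only [hf0, map_zero, mul_zero, zero_mul]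
      · rw [eulerDeriv_add (differentiableAt_of_mem hS hs.1) (differentiableAt_of_mem hpd hs.1),
          hθS s hs, hθ s hs]
        noncomm_ring
  obtain ⟨K, hK⟩ := Gr.exists_bound
  obtain ⟨S, u, w, hS, -, huE, hS1, hS0, -, -, hθS⟩ := key K
  refine ⟨S, hS, hS0, hS1, fun s hs j => ?_⟩
  have : u s = 0 := by
    have := huE s hs.1
    rwa [hK K le_rfl, Submodule.mem_bot] at this
  rw [hθS s hs, this]
  noncomm_ring

/-- The intertwiner `u` a priori lies only in the associative algebra. Its logarithm is found by
correcting `G` by the leading term `x` of `u - e^G`: `θ_j x` is a difference of components of `h_j`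
and of the form of `G`, both in `g`, and `x 0 = 0`, so `x` takes values in `g`. -/
theorem exists_solution (hg : ∀ x ∈ g, ∀ y ∈ g, x * y - y * x ∈ g)
    (hM : ∀ j, M j ∈ Gr.E 1 ⊓ g) (hMc : ∀ i j, M i * M j = M j * M i)
    {γ : (Fin n → ℂ) → A} (hγ : DifferentiableOn ℂ γ (polydisk n r))
    (hγE : ∀ s ∈ polydisk n r, γ s ∈ Gr.E 1 ⊓ g) (hγ0 : γ 0 = 0)
    (hflat : ∀ s ∈ puncturedPolydisk n r, ∀ i j,
      higgsForm M γ i s * higgsForm M γ j s = higgsForm M γ j s * higgsForm M γ i s) :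
    ∃ Γ : (Fin n → ℂ) → A, DifferentiableOn ℂ Γ (polydisk n r) ∧
      (∀ s ∈ polydisk n r, Γ s ∈ Gr.neg g) ∧ Γ 0 = 0 ∧
      (∀ s ∈ puncturedPolydisk n r, ∀ j, logForm M Γ j s ∈ Gr.E 1 ⊓ g) ∧
      ∀ s ∈ polydisk n r, Gr.proj 1 (Γ s) = γ s := by
  set h := higgsForm M γ with hh
  have hhE : ∀ s ∈ polydisk n r, ∀ j, h j s ∈ Gr.E 1 ⊓ g := fun s hs j =>
    higgsForm_mem hM hγ hγE hs j
  obtain ⟨u, hu, hu0, hu1, hui⟩ := exists_intertwines Gr (fun j => (hM j).1) hMc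
    (differentiableOn_higgsForm hγ) (higgsForm_zero γ) (fun s hs j => (hhE s hs j).1)
    (fun s hs => eulerDeriv_higgsForm_comm hγ hs.1) hflat
  have key : ∀ k : ℕ, ∃ G : (Fin n → ℂ) → A, DifferentiableOn ℂ G (polydisk n r) ∧
      (∀ s ∈ polydisk n r, G s ∈ Gr.neg g) ∧ G 0 = 0 ∧
      ∀ s ∈ polydisk n r, u s - exp (G s) ∈ Gr.tail (k + 1) := by
    intro k
    induction k with
    | zero =>
      exact ⟨fun _ => 0, differentiableOn_const _, fun _ _ => Submodule.zero_mem _, rfl,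
        fun s hs => by simpa using hu1 s hs⟩
    | succ k ih =>
      obtain ⟨G, hG, hGn, hG0, hGu⟩ := ih
      set x : (Fin n → ℂ) → A := fun s => Gr.proj (k + 1) (u s - exp (G s)) with hx
      have hxd : DifferentiableOn ℂ x (polydisk n r) :=
        (Gr.proj (k + 1)).differentiable.comp_differentiableOn (hu.sub (differentiableOn_exp hG))
      have hx0 : x 0 = 0 := by simp [hx, hu0, hG0]
      have hxE : ∀ s, x s ∈ Gr.E (k + 1) := fun s => Gr.proj_mem _ _
      have hux : ∀ s ∈ polydisk n r, u s - exp (G s) - x s ∈ Gr.tail (k + 1 + 1) := fun s hs =>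
        LowerGrading.sub_proj_mem_tail (hGu s hs)
      have hxg : ∀ s ∈ polydisk n r, x s ∈ g := by
        refine mem_of_eulerDeriv_mem hxd (by rw [hx0]; exact g.zero_mem) fun s hs j => ?_
        have h1 := logForm_add_eulerDeriv_sub_mem_tail
          (fun j => LowerGrading.E_le_tail le_rfl (hM j).1) hui hu hG hxd
          (fun s hs => LowerGrading.neg_le_tail (hGn s hs))
          (fun s _ => LowerGrading.E_le_tail le_rfl (hxE s)) hux
          (fun s hs j => LowerGrading.E_le_tail le_rfl (hhE s hs.1 j).1) hs j
        have h2 := LowerGrading.proj_eq_zero_of_mem_tail (k := k + 1) (Nat.lt_succ_self _) h1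
        rw [map_sub, map_add, Gr.proj_same _ _ (eulerDeriv_mem isOpen_polydisk hs.1
          (differentiableAt_of_mem hxd hs.1) (fun s _ => hxE s) j)] at h2
        have h3 : eulerDeriv j x s =
            Gr.proj (k + 1) (h j s) - Gr.proj (k + 1) (logForm M G j s) := by
          rw [eq_sub_iff_add_eq, add_comm]; exact sub_eq_zero.1 h2
        rw [h3]
        exact g.sub_mem (LowerGrading.proj_mem_of_mem_neg
            (LowerGrading.inf_le_neg le_rfl (hhE s hs.1 j)) _).2
          (LowerGrading.proj_mem_of_mem_neg (logForm_mem_neg hg hM hG hGn hs.1 j) _).2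
      refine ⟨fun s => G s + x s, hG.add hxd, fun s hs => Submodule.add_mem _ (hGn s hs)
        (LowerGrading.inf_le_neg (by omega) ⟨hxE s, hxg s hs⟩), by simp only [hG0, hx0, add_zero],
        fun s hs => ?_⟩
      have := Submodule.sub_mem _ (hux s hs) (LowerGrading.exp_add_sub_mem_tail (m := k + 1)
        (by omega) (LowerGrading.neg_le_tail (hGn s hs))
        (LowerGrading.E_le_tail le_rfl (hxE s)))
      convert this using 1
      abel
  obtain ⟨K, hK⟩ := Gr.exists_tail_eq_bot
  obtain ⟨Γ, hΓ, hΓn, hΓ0, hΓu⟩ := key K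
  have hue : ∀ s ∈ polydisk n r, u s = exp (Γ s) := fun s hs => by
    have := LowerGrading.tail_anti (Nat.le_succ K) (hΓu s hs)
    rwa [hK, Submodule.mem_bot, sub_eq_zero] at this
  have hlog : ∀ s ∈ puncturedPolydisk n r, ∀ j, logForm M Γ j s = h j s := fun s hs j =>
    logForm_eq_of_intertwines hui hue hs j
  refine ⟨Γ, hΓ, hΓn, hΓ0, fun s hs j => by rw [hlog s hs]; exact hhE s hs.1 j, ?_⟩
  -- The form of `Γ` is both `M_j + θ_jγ` and `M_j + θ_jΓ_1`, and `γ` and `Γ_1` vanish at 0.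
  refine eqOn_of_eulerDeriv_eq ((Gr.proj 1).differentiable.comp_differentiableOn hΓ) hγ
    (by simp only [hΓ0, hγ0, map_zero]) fun s hs j => ?_
  have h1 := logForm_eq_higgsForm hM hΓ hΓn
    (fun s hs j => by rw [hlog s hs]; exact (hhE s hs.1 j).1) hs j
  rw [hlog s hs, hh, higgsForm, higgsForm] at h1
  exact (add_left_cancel h1).symm

end Solutions

end
end LimitHodge

namespace LimitHodge

noncomputable section

open Set

/-! ### The grading of `End V` and the Lie algebra -/

section HomGrading

variable {V : Type*} [NormedAddCommGroup V] [NormedSpace ℂ V] {U : ℤ → Submodule ℂ V}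

/-- The endomorphisms of degree `b` with respect to `U`. -/
def homDegree (U : ℤ → Submodule ℂ V) (b : ℤ) : Submodule ℂ (V →L[ℂ] V) where
  carrier := {α | ∀ p, ∀ u ∈ U p, α u ∈ U (p + b)}
  zero_mem' := fun p u _ => by simp
  add_mem' := fun hα hβ p u hu => (U (p + _)).add_mem (hα p u hu) (hβ p u hu)
  smul_mem' := fun c _ hα p u hu => (U (p + _)).smul_mem c (hα p u hu)

theorem clm_ext_of_iSup_eq_top (htop : ⨆ p, U p = ⊤) {α β : V →L[ℂ] V}
    (h : ∀ p, ∀ u ∈ U p, α u = β u) : α = β := by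
  ext v
  have hle : ⨆ p, U p ≤ LinearMap.eqLocus (α : V →ₗ[ℂ] V) β :=
    iSup_le fun p u hu => h p u hu
  exact hle (by rw [htop]; trivial : v ∈ ⨆ p, U p)

theorem isCompl_iSup_ne (hind : iSupIndep U) (htop : ⨆ p, U p = ⊤) (p : ℤ) :
    IsCompl (U p) (⨆ j, ⨆ (_ : j ≠ p), U j) :=
  ⟨hind p, codisjoint_iff.2 (by rw [← iSup_split_single, htop])⟩

variable [FiniteDimensional ℂ V]

/-- The projection of `V` to `U p`. -/
def gradedProj (hind : iSupIndep U) (htop : ⨆ p, U p = ⊤) (p : ℤ) : V →L[ℂ] V :=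
  LinearMap.toContinuousLinearMap ((U p).projection _ (isCompl_iSup_ne hind htop p))

theorem gradedProj_mem (hind : iSupIndep U) (htop : ⨆ p, U p = ⊤) (p : ℤ) (v : V) :
    gradedProj hind htop p v ∈ U p :=
  Submodule.projection_apply_mem _ _

theorem gradedProj_same (hind : iSupIndep U) (htop : ⨆ p, U p = ⊤) {p : ℤ} {v : V}
    (hv : v ∈ U p) : gradedProj hind htop p v = v :=
  Submodule.projection_apply_of_mem_left _ hv

theorem gradedProj_other (hind : iSupIndep U) (htop : ⨆ p, U p = ⊤) {p j : ℤ} (hj : j ≠ p)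
    {v : V} (hv : v ∈ U j) : gradedProj hind htop p v = 0 := by
  have : v ∈ (⨆ j, ⨆ (_ : j ≠ p), U j) := (le_iSup₂_of_le j hj le_rfl : U j ≤ _) hv
  rw [← Submodule.ker_projection (isCompl_iSup_ne hind htop p)] at this
  exact this

/-- The projection of the endomorphisms of `V` to those of degree `-k`. -/
def homProj (hind : iSupIndep U) (htop : ⨆ p, U p = ⊤) (B k : ℕ) :
    (V →L[ℂ] V) →L[ℂ] (V →L[ℂ] V) :=
  ∑ p ∈ Finset.Icc (-(B : ℤ)) B, ContinuousLinearMap.mulLeftRight ℂ (V →L[ℂ] V)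
    (gradedProj hind htop (p + -(k : ℤ))) (gradedProj hind htop p)

theorem homProj_apply_apply (hind : iSupIndep U) (htop : ⨆ p, U p = ⊤) {B : ℕ}
    (hB : ∀ p : ℤ, (B : ℤ) < |p| → U p = ⊥) (k : ℕ) (α : V →L[ℂ] V) {p : ℤ} {u : V}
    (hu : u ∈ U p) :
    homProj hind htop B k α u = gradedProj hind htop (p + -(k : ℤ)) (α u) := by
  have e : homProj hind htop B k α u = ∑ q ∈ Finset.Icc (-(B : ℤ)) B,
      gradedProj hind htop (q + -(k : ℤ)) (α (gradedProj hind htop q u)) := by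
    simp [homProj]
  rw [e]
  by_cases hp : p ∈ Finset.Icc (-(B : ℤ)) B
  · rw [Finset.sum_eq_single_of_mem p hp fun q _ hq => by
      rw [gradedProj_other hind htop hq.symm hu, map_zero, map_zero], gradedProj_same _ _ hu]
  · have hu0 : u = 0 := by
      have hBp : (B : ℤ) < |p| := by
        rw [Finset.mem_Icc] at hp
        rw [lt_abs]
        omega
      rwa [hB p hBp, Submodule.mem_bot] at hu
    simp [hu0]

theorem homProj_other (hind : iSupIndep U) (htop : ⨆ p, U p = ⊤) {B : ℕ}
    (hB : ∀ p : ℤ, (B : ℤ) < |p| → U p = ⊥) {k : ℕ} {b : ℤ} (hb : b ≠ -(k : ℤ)) {α : V →L[ℂ] V}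
    (hα : α ∈ homDegree U b) : homProj hind htop B k α = 0 := by
  refine clm_ext_of_iSup_eq_top htop fun p u hu => ?_
  rw [homProj_apply_apply hind htop hB k α hu,
    gradedProj_other hind htop (by simpa using hb) (hα p u hu)]
  rfl

/-- The grading of the endomorphisms of `V` of nonpositive degree. -/
def homGrading (hind : iSupIndep U) (htop : ⨆ p, U p = ⊤) {B : ℕ}
    (hB : ∀ p : ℤ, (B : ℤ) < |p| → U p = ⊥) : LowerGrading (V →L[ℂ] V) where
  E k := homDegree U (-(k : ℤ))
  proj k := homProj hind htop B k
  proj_mem k α p u hu := by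
    rw [homProj_apply_apply hind htop hB k α hu]
    exact gradedProj_mem _ _ _ _
  proj_same k α hα := by
    refine clm_ext_of_iSup_eq_top htop fun p u hu => ?_
    rw [homProj_apply_apply hind htop hB k α hu, gradedProj_same _ _ (hα p u hu)]
  proj_other k l hkl α hα := homProj_other hind htop hB (by omega) hα
  mul_mem k l α hα β hβ p u hu := by
    have := hα _ _ (hβ p u hu)
    rwa [show p + -((k + l : ℕ) : ℤ) = p + -(l : ℤ) + -(k : ℤ) by push_cast; ring]
  one_mem p u hu := by simpa using hu
  exists_bound := by
    -- Nonzero `U p` have `|p| ≤ B`, so a shift by more than `2 * B` leaves this range.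
    refine ⟨2 * B + 1, fun k hk => (Submodule.eq_bot_iff _).2 fun α hα => ?_⟩
    refine clm_ext_of_iSup_eq_top htop fun p u hu => ?_
    by_cases hp : (B : ℤ) < |p|
    · rw [hB p hp, Submodule.mem_bot] at hu
      rw [hu]; simp
    · have h1 := hα p u hu
      rw [hB (p + -(k : ℤ)) (by rw [lt_abs]; rw [lt_abs] at hp; omega), Submodule.mem_bot] at h1
      rw [h1]; rfl

end HomGrading

theorem commutator_mem_lieG {V : Type*} [NormedAddCommGroup V] [NormedSpace ℂ V]
    {W : ℤ → Submodule ℂ V} {S : ∀ k, LinearMap.BilinForm ℂ (Gr W k)} {α β : V →L[ℂ] V}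
    (hα : α ∈ lieG W S) (hβ : β ∈ lieG W S) : α * β - β * α ∈ lieG W S := by
  obtain ⟨ha, hα⟩ := hα
  obtain ⟨hb, hβ⟩ := hβ
  refine ⟨fun k v hv => (W k).sub_mem (ha k _ (hb k v hv)) (hb k _ (ha k v hv)),
    fun k x y => ?_⟩
  have e : ∀ (h : ∀ k, ∀ v ∈ W k, (α * β - β * α) v ∈ W k) (z : Gr W k),
      grMap W (α * β - β * α) h k z =
        grMap W α ha k (grMap W β hb k z) - grMap W β hb k (grMap W α ha k z) := fun h z => by
    obtain ⟨z, rfl⟩ := Submodule.Quotient.mk_surjective _ z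
    rfl
  have h1 := hα k (grMap W β hb k x) y
  have h2 := hβ k (grMap W α ha k x) y
  have h3 := hα k x (grMap W β hb k y)
  have h4 := hβ k x (grMap W α ha k y)
  simp only [e, map_sub, LinearMap.sub_apply]
  linear_combination h1 - h2 + h3 - h4

namespace LimitData

variable {V : Type*} [NormedAddCommGroup V] [NormedSpace ℂ V] [Module ℚ V] {n : ℕ}
  (D : LimitData V n)

theorem commutator_mem_lieAlg : ∀ x ∈ D.lieAlg, ∀ y ∈ D.lieAlg, x * y - y * x ∈ D.lieAlg :=
  fun _ hx _ hy => commutator_mem_lieG hx hy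

theorem wp_eq (a : ℤ) : D.wp a = homDegree D.U a ⊓ D.lieAlg := by
  ext α
  exact and_comm

theorem N_mem_wp (j : Fin n) : D.N j ∈ D.wp (-1) :=
  ⟨D.N_mem j, map_hodgeU_mem (D.N j) (D.N_rational j) (D.N_F j) (D.N_M j)⟩

variable [FiniteDimensional ℂ V]

/-- The grading of the endomorphisms of `V` by the limiting mixed Hodge structure. -/
def grading : LowerGrading (V →L[ℂ] V) :=
  homGrading D.isMixedHodgeStructure.iSupIndep_hodgeU D.isMixedHodgeStructure.iSup_hodgeU
    D.isMixedHodgeStructure.exists_bound_hodgeU.choose_spec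

theorem wp_neg (k : ℕ) : D.wp (-(k : ℤ)) = D.grading.E k ⊓ D.lieAlg := D.wp_eq _

theorem wp_neg_one : D.wp (-1) = D.grading.E 1 ⊓ D.lieAlg := D.wp_neg 1

theorem qInf_eq : D.qInf = D.grading.neg D.lieAlg := by
  refine le_antisymm (iSup₂_le fun a ha => ?_) (iSup₂_le fun k hk => ?_)
  · obtain ⟨k, rfl⟩ : ∃ k : ℕ, a = -(k : ℤ) := ⟨a.natAbs, by omega⟩
    rw [wp_neg]
    exact LowerGrading.inf_le_neg (by omega)
  · rw [← wp_neg]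
    exact le_iSup₂_of_le (-(k : ℤ)) (by omega) le_rfl

/-- Any decomposition into the `℘_b` gives the same component, since the projection kills every
summand of degree other than `-k`; the choice made by `Classical.epsilon` is immaterial. -/
theorem component_eq (k : ℕ) {α : V →L[ℂ] V} (hα : α ∈ D.qInf) :
    D.component (-(k : ℤ)) α = D.grading.proj k α := by
  have hα' : α ∈ ⨆ a, D.wp a :=
    (iSup₂_le fun a _ => le_iSup (fun a => D.wp a) a : D.qInf ≤ _) hα
  have hex : ∃ β : ℤ →₀ (V →L[ℂ] V), (∀ b, β b ∈ D.wp b) ∧ (β.sum fun _ x => x) = α :=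
    (Submodule.mem_iSup_iff_exists_finsupp _ _).1 hα'
  obtain ⟨hβ, hsum⟩ := Classical.epsilon_spec hex
  rw [component]
  set β := Classical.epsilon fun β : ℤ →₀ (V →L[ℂ] V) =>
    (∀ b, β b ∈ D.wp b) ∧ (β.sum fun _ x => x) = α
  rw [← hsum, Finsupp.sum, map_sum]
  have hother : ∀ b, b ≠ -(k : ℤ) → D.grading.proj k (β b) = 0 := fun b hb =>
    homProj_other _ _ D.isMixedHodgeStructure.exists_bound_hodgeU.choose_spec hb (hβ b).2
  have hsame : D.grading.proj k (β (-(k : ℤ))) = β (-(k : ℤ)) :=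
    D.grading.proj_same k _ (hβ _).2
  rw [Finset.sum_eq_single (-(k : ℤ)) (fun b _ hb => hother b hb) fun hk => by
    rw [Finsupp.notMem_support_iff.1 hk, map_zero], hsame]

end LimitData

end
end LimitHodge

namespace LimitHodge

noncomputable section

open NormedSpace (exp)
open Set

/-! ### Functions on the polydisk and their extensions -/

section Extension

variable {n : ℕ} {r : ℝ} {E : Type*} [Zero E] {s : Fin n → ℂ}

theorem ext_of_mem (f : polydisk n r → E) (hs : s ∈ polydisk n r) : ext f s = f ⟨s, hs⟩ :=
  Subtype.val_injective.extend_apply f 0 ⟨s, hs⟩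

theorem ext_apply (f : polydisk n r → E) (s : polydisk n r) : ext f s = f s :=
  Subtype.val_injective.extend_apply f 0 s

theorem ext_of_notMem (f : polydisk n r → E) (hs : s ∉ polydisk n r) : ext f s = 0 :=
  Function.extend_apply' _ _ _ fun ⟨t, ht⟩ => hs (ht ▸ t.2)

theorem ext_comp {F : E → E} (hF : F 0 = 0) (f : polydisk n r → E) :
    ext (fun s => F (f s)) = fun s => F (ext f s) := by
  funext s
  by_cases hs : s ∈ polydisk n r
  · rw [ext_of_mem _ hs, ext_of_mem _ hs]
  · rw [ext_of_notMem _ hs, ext_of_notMem _ hs, hF]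

theorem ext_restrict (f : (Fin n → ℂ) → E) :
    EqOn (ext fun s : polydisk n r => f s) f (polydisk n r) := fun _ hs => ext_of_mem _ hs

theorem eq_of_eqOn_ext {f g : polydisk n r → E} (h : EqOn (ext f) (ext g) (polydisk n r)) :
    f = g :=
  funext fun s => by rw [← ext_apply f, h s.2, ext_apply]

end Extension

/-! ### Parallel transport -/

section ParallelTransport

variable {V : Type*} [NormedAddCommGroup V] [NormedSpace ℂ V] [FiniteDimensional ℂ V]

/-- The parallel translation of `d + H dt` along a path, if a gauge transformation `P` takes it to
the connection with constant form `N`. -/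
theorem parallelTransport_iff {P Q H : ℝ → (V →L[ℂ] V)} {N T : V →L[ℂ] V}
    (hP : ∀ t, HasDerivAt P (P t * H t - N * P t) t) (hQ : ∀ t, DifferentiableAt ℝ Q t)
    (hQP : ∀ t, Q t * P t = 1) (hPQ : ∀ t, P t * Q t = 1) :
    (∀ v : V, ∃ σ : ℝ → V, σ 0 = v ∧ σ 1 = T v ∧ ∀ t ∈ Icc (0 : ℝ) 1,
      HasDerivWithinAt σ (-(H t (σ t))) (Icc 0 1) t) ↔ T = Q 1 * exp (-N) * P 0 := by
  have hexp : ∀ (K : V →L[ℂ] V) (t : ℝ),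
      HasDerivAt (fun t : ℝ => exp ((t : ℂ) • K)) (exp ((t : ℂ) • K) * K) t := fun K t =>
    ((hasDerivAt_exp_smul' K (t : ℂ)).scomp t Complex.ofRealCLM.hasDerivAt).congr_deriv
      (one_smul ℂ _)
  have hexp' : ∀ (K : V →L[ℂ] V) (t : ℝ),
      HasDerivAt (fun t : ℝ => exp ((t : ℂ) • K)) (K * exp ((t : ℂ) • K)) t := fun K t =>
    ((hasDerivAt_exp_smul K (t : ℂ)).scomp t Complex.ofRealCLM.hasDerivAt).congr_deriv
      (one_smul ℂ _)
  have e0 : ∀ K : V →L[ℂ] V, exp (((0 : ℝ) : ℂ) • K) = 1 := fun K => by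
    rw [Complex.ofReal_zero, zero_smul, NormedSpace.exp_zero]
  have e1 : ∀ K : V →L[ℂ] V, exp (((1 : ℝ) : ℂ) • K) = exp K := fun K => by
    rw [Complex.ofReal_one, one_smul]
  constructor
  · intro h
    ext v
    obtain ⟨σ, hσ0, hσ1, hσ⟩ := h v
    have hR : ∀ t : ℝ, HasDerivAt (fun t : ℝ => exp ((t : ℂ) • N) * P t)
        (exp ((t : ℂ) • N) * (P t * H t)) t := fun t => by
      refine ((hexp N t).fun_mul (hP t)).congr_deriv ?_
      noncomm_ring
    -- The gauge takes a horizontal `σ` to a solution of `τ' = -N τ`, so `e^{tN} P σ` is constant.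
    have hτ : ∀ t ∈ Icc (0 : ℝ) 1, HasDerivWithinAt
        (fun t : ℝ => (exp ((t : ℂ) • N) * P t) (σ t)) 0 (Icc 0 1) t := by
      intro t ht
      have h1 : HasDerivWithinAt
          (fun t : ℝ => (exp ((t : ℂ) • N) * P t).restrictScalars ℝ (σ t)) _ (Icc 0 1) t :=
        (((ContinuousLinearMap.restrictScalarsL ℂ V V ℝ ℝ).hasFDerivAt.comp_hasDerivAt t
          (hR t)).hasDerivWithinAt).clm_apply (hσ t ht)
      refine h1.congr_deriv ?_
      simp
    have hconst := (convex_Icc (0 : ℝ) 1).norm_image_sub_le_of_norm_hasDerivWithin_le (C := 0)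
      hτ (fun t ht => by simp) (left_mem_Icc.2 zero_le_one) (right_mem_Icc.2 zero_le_one)
    simp only [e0, e1, one_mul, hσ0, hσ1, zero_mul, norm_le_zero_iff, sub_eq_zero] at hconst
    have h2 : exp (-N) * (exp N * P 1) = P 1 := by
      rw [← mul_assoc, exp_neg_mul_exp, one_mul]
    have h3 : (Q 1 * (exp (-N) * (exp N * P 1))) (T v) = (Q 1 * exp (-N)) (P 0 v) := by
      rw [← hconst]; rfl
    rw [h2, hQP] at h3
    exact h3
  · rintro rfl v
    -- Differentiating `Q P = 1` gives the equation of the inverse gauge, which makes `Q e^{-tN}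
    -- P(0) v` horizontal.
    have hQ' : ∀ t, HasDerivAt Q (Q t * N - H t * Q t) t := by
      intro t
      have h1 := (hQ t).hasDerivAt.fun_mul (hP t)
      have h2 : HasDerivAt (fun t => Q t * P t) 0 t := by
        simp only [hQP]; exact hasDerivAt_const t 1
      have h3 := h1.unique h2
      refine (hQ t).hasDerivAt.congr_deriv ?_
      calc deriv Q t = (deriv Q t * P t + Q t * (P t * H t - N * P t)) * Q t
            - (Q t * P t) * H t * Q t + Q t * N * (P t * Q t)
            + deriv Q t * (1 - P t * Q t) := by noncomm_ring
        _ = _ := by rw [h3, hQP, hPQ]; noncomm_ring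
    refine ⟨fun t => (Q t * exp ((t : ℂ) • (-N)) * P 0) v, ?_, ?_, fun t _ => ?_⟩
    · simp only [e0, mul_one, hQP]; rfl
    · simp only [e1]
    · have h1 : HasDerivAt (fun t : ℝ => Q t * exp ((t : ℂ) • (-N)) * P 0)
          (-(H t * (Q t * exp ((t : ℂ) • (-N)) * P 0))) t := by
        refine (((hQ' t).fun_mul (hexp' (-N) t)).mul_const (P 0)).congr_deriv ?_
        noncomm_ring
      exact (((ContinuousLinearMap.apply ℂ V v).restrictScalars ℝ).hasFDerivAt.comp_hasDerivAt t
        h1).hasDerivWithinAt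

end ParallelTransport

/-! ### Transfer to the limiting mixed Hodge structure -/

namespace LimitData

variable {V : Type*} [NormedAddCommGroup V] [NormedSpace ℂ V] [Module ℚ V] {n : ℕ}
  (D : LimitData V n) {r : ℝ} {s : Fin n → ℂ}

/-- The residues `N_j / 2πi` of `Ω`. -/
def residue (j : Fin n) : V →L[ℂ] V := (1 / (2 * Real.pi * Complex.I) : ℂ) • D.N j

theorem two_pi_I_smul_residue (j : Fin n) : (2 * Real.pi * Complex.I : ℂ) • D.residue j = D.N j := by
  rw [residue, smul_smul, mul_one_div_cancel Complex.two_pi_I_ne_zero, one_smul]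

theorem residue_comm (i j : Fin n) : D.residue i * D.residue j = D.residue j * D.residue i := by
  simp only [residue, smul_mul_smul_comm, D.N_comm i j]

theorem smul_omega {j : Fin n} (hs : s j ≠ 0) : s j • D.omega j s = D.residue j := by
  rw [omega, residue, smul_smul]
  congr 1
  field_simp

theorem smul_higgs (g : polydisk n r → (V →L[ℂ] V)) {j : Fin n} (hs : s j ≠ 0) :
    s j • D.higgs g j s = higgsForm D.residue (ext g) j s := by
  rw [higgs, smul_add, D.smul_omega hs]
  rfl

theorem commute_higgs_iff (g : polydisk n r → (V →L[ℂ] V)) {i j : Fin n} (hi : s i ≠ 0)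
    (hj : s j ≠ 0) : D.higgs g i s * D.higgs g j s - D.higgs g j s * D.higgs g i s = 0 ↔
      higgsForm D.residue (ext g) i s * higgsForm D.residue (ext g) j s =
        higgsForm D.residue (ext g) j s * higgsForm D.residue (ext g) i s := by
  rw [← D.smul_higgs g hi, ← D.smul_higgs g hj, smul_mul_smul_comm, smul_mul_smul_comm,
    mul_comm (s j), ← sub_eq_zero (a := (s i * s j) • _), ← smul_sub,
    smul_eq_zero_iff_right (mul_ne_zero hi hj)]

theorem pderiv_omega {i j : Fin n} (hij : i ≠ j) (hs : s j ≠ 0) :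
    DifferentiableAt ℂ (D.omega j) s ∧ pderiv i (D.omega j) s = 0 := by
  have h1 : HasFDerivAt (fun s : Fin n → ℂ => s j)
    (ContinuousLinearMap.proj (R := ℂ) (φ := fun _ : Fin n => ℂ) j) s := hasFDerivAt_apply j s
  have h0 : HasDerivAt (fun z : ℂ => 1 / z) (-(s j ^ 2)⁻¹) (s j) := by
    simpa only [one_div] using hasDerivAt_inv hs
  have h2 : HasDerivAt (fun z : ℂ => (1 / (2 * Real.pi * Complex.I) * (1 / z)) • D.N j) _ (s j) :=
    (h0.const_mul (1 / (2 * Real.pi * Complex.I))).smul_const (D.N j)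
  have h3 := h2.hasFDerivAt.comp s h1
  refine ⟨h3.differentiableAt, ?_⟩
  rw [pderiv, show D.omega j = (fun z : ℂ => (1 / (2 * Real.pi * Complex.I) * (1 / z)) • D.N j) ∘
    fun s : Fin n → ℂ => s j from rfl, h3.fderiv]
  simp [hij.symm]

variable [FiniteDimensional ℂ V]

theorem residue_mem (j : Fin n) : D.residue j ∈ D.grading.E 1 ⊓ D.lieAlg := by
  rw [← wp_neg_one]
  exact Submodule.smul_mem _ _ (D.N_mem_wp j)

theorem smul_form (G : (Fin n → ℂ) → (V →L[ℂ] V)) {j : Fin n} (hs : s j ≠ 0) :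
    s j • D.form G j s = logForm D.residue G j s := by
  have h : expNegAd (G s) (D.omega j s) = exp (-(G s)) * D.omega j s * exp (G s) :=
    exp_neg_adjointOp_apply (G s) (D.omega j s)
  rw [form, h, smul_add, logForm, mul_add, ← D.smul_omega hs, eulerDeriv, add_comm]
  congr 1
  · rw [mul_smul_comm]
  · rw [smul_mul_assoc, mul_smul_comm, mul_assoc]

theorem form_mem_iff (G : (Fin n → ℂ) → (V →L[ℂ] V)) {j : Fin n} (hs : s j ≠ 0)
    (Q : Submodule ℂ (V →L[ℂ] V)) : D.form G j s ∈ Q ↔ logForm D.residue G j s ∈ Q := by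
  rw [← D.smul_form G hs, Submodule.smul_mem_iff _ hs]

variable {D} {Γ : polydisk n r → (V →L[ℂ] V)}

theorem IsSolution.ext_mem (h : D.IsSolution Γ) :
    ∀ s ∈ polydisk n r, ext Γ s ∈ D.grading.neg D.lieAlg := fun s hs => by
  rw [ext_of_mem Γ hs, ← qInf_eq]
  exact h.2.1 _

theorem IsSolution.logForm_mem (h : D.IsSolution Γ) (s : Fin n → ℂ)
    (hs : s ∈ puncturedPolydisk n r) (j : Fin n) :
    logForm D.residue (ext Γ) j s ∈ D.grading.E 1 := by
  have := h.2.2.2 s hs j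
  rw [D.form_mem_iff _ (hs.2 j), wp_neg_one] at this
  exact this.1

theorem ext_componentMap (hΓ : ∀ s, Γ s ∈ D.qInf) (k : ℕ) :
    ext (D.componentMap (-(k : ℤ)) Γ) = fun s => D.grading.proj k (ext Γ s) := by
  rw [← ext_comp (map_zero _)]
  congr 1
  funext s
  exact D.component_eq k (hΓ s)

theorem ext_componentMap_neg_one (hΓ : ∀ s, Γ s ∈ D.qInf) :
    ext (D.componentMap (-1) Γ) = fun s => D.grading.proj 1 (ext Γ s) :=
  ext_componentMap hΓ 1

theorem ext_truncation (hΓ : ∀ s, Γ s ∈ D.qInf) (k : ℕ) :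
    ext (D.truncation k Γ) = fun s => D.grading.trunc k (ext Γ s) := by
  have h0 : D.grading.trunc k 0 = 0 := by simp [LowerGrading.trunc]
  rw [← ext_comp h0]
  congr 1
  funext s
  exact Finset.sum_congr rfl fun i _ => D.component_eq i (hΓ s)

theorem IsSolution.intertwines (h : D.IsSolution Γ) : Intertwines r D.residue
    (higgsForm D.residue (ext (D.componentMap (-1) Γ))) fun s => exp (ext Γ s) := by
  rw [ext_componentMap_neg_one h.2.1]
  exact intertwines_of_solution D.residue_mem h.1 h.ext_mem h.logForm_mem

theorem IsSolution.differentiableOn_proj (h : D.IsSolution Γ) (k : ℕ) :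
    DifferentiableOn ℂ (fun s => D.grading.proj k (ext Γ s)) (polydisk n r) :=
  (D.grading.proj k).differentiable.comp_differentiableOn h.1

theorem IsSolution.isHiggsMap (h : D.IsSolution Γ) : D.IsHiggsMap (D.componentMap (-1) Γ) := by
  have he := ext_componentMap_neg_one h.2.1
  have hd := h.differentiableOn_proj 1
  refine ⟨?_, fun s => ?_, ?_, fun s hs i j => ?_⟩
  · rw [IsHolomorphic, he]; exact hd
  · rw [wp_neg_one, ← ext_apply (D.componentMap (-1) Γ) s, he]
    exact LowerGrading.proj_mem_of_mem_neg (h.ext_mem s s.2) 1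
  · rw [he]; simp only [h.2.2.1, map_zero]
  · rw [D.commute_higgs_iff _ (hs.2 i) (hs.2 j)]
    have hd' : DifferentiableOn ℂ (ext (D.componentMap (-1) Γ)) (polydisk n r) := by
      rw [he]; exact hd
    exact commute_of_intertwines (v := fun s => exp (-(ext Γ s))) D.residue_comm
      (differentiableOn_exp h.1) (differentiableOn_higgsForm hd')
      (fun s hs => eulerDeriv_higgsForm_comm hd' hs.1) h.intertwines
      (fun s => exp_neg_mul_exp _) hs i j

variable (D) in
theorem injOn_componentMap : InjOn (D.componentMap (-1))
    {Γ : polydisk n r → (V →L[ℂ] V) | D.IsSolution Γ} := by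
  intro Γ hΓ Γ' hΓ' heq
  refine eq_of_eqOn_ext (proj_eqOn_of_solution D.residue_mem hΓ.1 hΓ.ext_mem hΓ.logForm_mem
    hΓ.2.2.1 hΓ'.1 hΓ'.ext_mem hΓ'.logForm_mem hΓ'.2.2.1 fun s _ => ?_)
  have := congrArg ext heq
  rw [ext_componentMap_neg_one hΓ.2.1, ext_componentMap_neg_one hΓ'.2.1] at this
  exact congrFun this s

theorem IsHiggsMap.exists_isSolution {g : polydisk n r → (V →L[ℂ] V)} (hr : 0 < r)
    (hg : D.IsHiggsMap g) : ∃ Γ, D.IsSolution Γ ∧ D.componentMap (-1) Γ = g := by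
  obtain ⟨Γ, hΓ, hΓn, hΓ0, hlog, hproj⟩ := exists_solution (r := r) D.commutator_mem_lieAlg
    D.residue_mem D.residue_comm hg.1
    (fun s hs => by rw [ext_of_mem g hs, ← wp_neg_one]; exact hg.2.1 _) hg.2.2.1
    (fun s hs i j => (D.commute_higgs_iff g (hs.2 i) (hs.2 j)).1 (hg.2.2.2 s hs i j))
  have he : EqOn (ext fun s : polydisk n r => Γ s) Γ (polydisk n r) := ext_restrict Γ
  have hq : ∀ s : polydisk n r, Γ s ∈ D.qInf := fun s => by rw [qInf_eq]; exact hΓn s s.2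
  refine ⟨fun s => Γ s, ⟨hΓ.congr he, hq, ?_, fun s hs j => ?_⟩, ?_⟩
  · rw [he (zero_mem_polydisk hr), hΓ0]
  · rw [D.form_mem_iff _ (hs.2 j), wp_neg_one]
    have hexp : EqOn (fun s => exp (ext (fun s : polydisk n r => Γ s) s)) (fun s => exp (Γ s))
      (polydisk n r) := fun s hs => congrArg exp (he hs)
    have := hlog s hs j
    rwa [logForm, ← eulerDeriv_congr isOpen_polydisk hs.1 hexp, ← he hs.1] at this
  · funext s
    rw [← ext_apply g, ← hproj s s.2]
    exact D.component_eq 1 (hq s)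

/-- After multiplication by the nonzero `s j`, the condition prescribes the Euler derivatives of
`h`. The form of the truncation lies in `q`, so its component is the graded projection. -/
theorem IsSolution.eq_componentMap_iff (hΓ : D.IsSolution Γ) {k : ℕ} (hk : 2 ≤ k)
    (h : polydisk n r → (V →L[ℂ] V)) : h = D.componentMap (-(k : ℤ)) Γ ↔
      IsHolomorphic h ∧ (∀ s, h s ∈ D.wp (-(k : ℤ))) ∧ ext h 0 = 0 ∧
      ∀ s ∈ puncturedPolydisk n r, ∀ j, pderiv j (ext h) s =
        -D.component (-(k : ℤ)) (D.form (ext (D.truncation k Γ)) j s) := by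
  have he := ext_componentMap hΓ.2.1 k
  have hd := hΓ.differentiableOn_proj k
  have htd : DifferentiableOn ℂ (fun s => D.grading.trunc k (ext Γ s)) (polydisk n r) :=
    DifferentiableOn.fun_sum fun i _ => hΓ.differentiableOn_proj i
  have hrhs : ∀ s ∈ puncturedPolydisk n r, ∀ j,
      s j • -D.component (-(k : ℤ)) (D.form (ext (D.truncation k Γ)) j s) =
        eulerDeriv j (fun s => D.grading.proj k (ext Γ s)) s := by
    intro s hs j
    have hmem : D.form (ext (D.truncation k Γ)) j s ∈ D.qInf := by
      rw [D.form_mem_iff _ (hs.2 j), ext_truncation hΓ.2.1, qInf_eq]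
      exact logForm_mem_neg D.commutator_mem_lieAlg D.residue_mem htd
        (fun s hs => LowerGrading.trunc_mem_neg (hΓ.ext_mem s hs) k) hs.1 j
    rw [D.component_eq k hmem, smul_neg, ← map_smul, D.smul_form _ (hs.2 j),
      ext_truncation hΓ.2.1,
      eulerDeriv_proj_eq D.residue_mem hΓ.1 hΓ.ext_mem hΓ.logForm_mem hk hs j]
  constructor
  · rintro rfl
    refine ⟨?_, fun s => ?_, ?_, fun s hs j => ?_⟩
    · rw [IsHolomorphic, he]; exact hd
    · rw [wp_neg, ← ext_apply (D.componentMap (-(k : ℤ)) Γ) s, he]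
      exact LowerGrading.proj_mem_of_mem_neg (hΓ.ext_mem s s.2) k
    · rw [he]; simp only [hΓ.2.2.1, map_zero]
    · refine smul_right_injective _ (hs.2 j) ?_
      change s j • _ = s j • _
      rw [hrhs s hs j, he]
      rfl
  · rintro ⟨h1, -, h0, h2⟩
    refine eq_of_eqOn_ext ?_
    rw [he]
    refine eqOn_of_eulerDeriv_eq h1 hd (by simp only [h0, hΓ.2.2.1, map_zero]) fun s hs j => ?_
    rw [← hrhs s hs j, ← h2 s hs j]
    rfl

/-- The commutator term vanishes by hypothesis, and `Ω + ∂Γ_{-1}` is closed: each coefficient of `Ω`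
depends on its own variable only. -/
theorem IsHiggsMap.isFlat {g : polydisk n r → (V →L[ℂ] V)} (hg : D.IsHiggsMap g) :
    D.IsFlat g := by
  intro s hs i j
  rw [hg.2.2.2 s hs i j, add_zero]
  rcases eq_or_ne i j with rfl | hij
  · exact sub_self _
  have key : ∀ i j, i ≠ j → pderiv i (D.higgs g j) s = pderiv i (pderiv j (ext g)) s := by
    intro i j hij
    obtain ⟨hd, h0⟩ := D.pderiv_omega hij (hs.2 j)
    have hd' : DifferentiableAt ℂ (pderiv j (ext g)) s := differentiableAt_of_mem
      (hg.1.fderiv_apply_const isOpen_polydisk (Pi.single j 1)) hs.1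
    rw [pderiv] at h0
    rw [pderiv, show D.higgs g j = fun s => D.omega j s + pderiv j (ext g) s from rfl,
      fderiv_fun_add hd hd', add_apply, h0, zero_add]
    rfl
  rw [key i j hij, key j i hij.symm, sub_eq_zero]
  exact fderiv_fderiv_comm isOpen_polydisk hg.1 hs.1 _ _

theorem loop_mem {s : Fin n → ℂ} (hs : s ∈ puncturedPolydisk n r) (j : Fin n) (t : ℝ) :
    loop j s t ∈ puncturedPolydisk n r := by
  have hn : ‖Complex.exp (2 * Real.pi * Complex.I * t)‖ = 1 := by
    rw [show (2 * Real.pi * Complex.I * t : ℂ) = ((2 * Real.pi * t : ℝ) : ℂ) * Complex.I by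
      push_cast; ring, Complex.norm_exp_ofReal_mul_I]
  refine ⟨fun i => ?_, fun i => ?_⟩
  · rcases eq_or_ne i j with rfl | hij
    · simpa [loop, hn] using hs.1 i
    · simpa [loop, hij] using hs.1 i
  · rcases eq_or_ne i j with rfl | hij
    · simpa [loop, Complex.exp_ne_zero] using hs.2 i
    · simpa [loop, hij] using hs.2 i

theorem loop_zero (j : Fin n) (s : Fin n → ℂ) : loop j s 0 = s := by
  simp [loop]

theorem loop_one (j : Fin n) (s : Fin n → ℂ) : loop j s 1 = s := by
  simp [loop, Complex.exp_two_pi_mul_I]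

theorem hasDerivAt_loop (j : Fin n) (s : Fin n → ℂ) (t : ℝ) :
    HasDerivAt (loop j s) ((2 * Real.pi * Complex.I * loop j s t j) • Pi.single j (1 : ℂ)) t := by
  have h1 : HasDerivAt (fun t : ℝ => Complex.exp (2 * Real.pi * Complex.I * t) * s j)
      (2 * Real.pi * Complex.I * (Complex.exp (2 * Real.pi * Complex.I * t) * s j)) t := by
    have h2 : HasDerivAt (fun t : ℂ => 2 * Real.pi * Complex.I * t) (2 * Real.pi * Complex.I)
        (t : ℂ) := by
      simpa using (hasDerivAt_id (t : ℂ)).const_mul (2 * Real.pi * Complex.I : ℂ)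
    refine ((h2.cexp.mul_const (s j)).comp_ofReal).congr_deriv ?_
    ring
  rw [hasDerivAt_pi]
  intro i
  rcases eq_or_ne i j with rfl | hij
  · simpa [loop] using h1
  · simpa [loop, hij] using hasDerivAt_const t (s i)

theorem hasDerivAt_comp_loop {E : Type*} [NormedAddCommGroup E] [NormedSpace ℂ E]
    {f : (Fin n → ℂ) → E}
    (hf : DifferentiableOn ℂ f (polydisk n r)) {s : Fin n → ℂ} (hs : s ∈ puncturedPolydisk n r)
    (j : Fin n) (t : ℝ) : HasDerivAt (fun t => f (loop j s t))
      ((2 * Real.pi * Complex.I : ℂ) • eulerDeriv j f (loop j s t)) t := by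
  have h1 := ((differentiableAt_of_mem hf (loop_mem hs j t).1).hasFDerivAt.restrictScalars
    ℝ).comp_hasDerivAt t (hasDerivAt_loop j s t)
  refine h1.congr_deriv ?_
  rw [ContinuousLinearMap.coe_restrictScalars', map_smul, eulerDeriv, smul_smul]
  rfl

/-- Along the loop `ds_j / s_j = 2πi dt`, so the gauge `e^Γ` leads to the constant form `2πi M_j =
N_j`; the gauge has the same value at both ends of the loop. -/
theorem IsSolution.isMonodromy_iff (hΓ : D.IsSolution Γ) {s : Fin n → ℂ}
    (hs : s ∈ puncturedPolydisk n r) (j : Fin n) (T : V →L[ℂ] V) :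
    D.IsMonodromy (D.componentMap (-1) Γ) j s T ↔
      T = exp (-(ext Γ s)) * exp (-(D.N j)) * exp (ext Γ s) := by
  have hH : ∀ t, (2 * Real.pi * Complex.I * loop j s t j) •
      D.higgs (D.componentMap (-1) Γ) j (loop j s t) = (2 * Real.pi * Complex.I : ℂ) •
        higgsForm D.residue (ext (D.componentMap (-1) Γ)) j (loop j s t) := fun t => by
    rw [← D.smul_higgs _ ((loop_mem hs j t).2 j), smul_smul]
  have key := parallelTransport_iff (P := fun t => exp (ext Γ (loop j s t)))
    (Q := fun t => exp (-(ext Γ (loop j s t))))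
    (H := fun t => (2 * Real.pi * Complex.I * loop j s t j) •
      D.higgs (D.componentMap (-1) Γ) j (loop j s t)) (N := D.N j) (T := T)
    (fun t => by
      refine (hasDerivAt_comp_loop (differentiableOn_exp hΓ.1) hs j t).congr_deriv ?_
      have := hΓ.intertwines _ (loop_mem hs j t) j
      rw [eq_sub_of_add_eq this, hH, smul_sub, mul_smul_comm, ← D.two_pi_I_smul_residue j,
        smul_mul_assoc])
    (fun t => (hasDerivAt_comp_loop (differentiableOn_exp hΓ.1.neg) hs j t).differentiableAt)
    (fun t => exp_neg_mul_exp _) (fun t => exp_mul_exp_neg _)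
  simp only [loop_zero, loop_one] at key
  exact key

end LimitData

end
end LimitHodge



theorem theorem6p16 {V : Type*} [NormedAddCommGroup V] [NormedSpace ℂ V] [Module ℚ V]
    [FiniteDimensional ℂ V] {n : ℕ} (D : LimitHodge.LimitData V n) {r : ℝ} (hr : 0 < r) :
    -- the correspondence `Γ ↦ Γ_{-1}` is a bijection
    Set.BijOn (D.componentMap (-1))
      {Γ : LimitHodge.polydisk n r → (V →L[ℂ] V) | D.IsSolution Γ}
      {g : LimitHodge.polydisk n r → (V →L[ℂ] V) | D.IsHiggsMap g} ∧
    ∀ Γ : LimitHodge.polydisk n r → (V →L[ℂ] V), D.IsSolution Γ →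
      -- the inductive determination of the higher components
      (∀ k : ℕ, 2 ≤ k → ∀ h : LimitHodge.polydisk n r → (V →L[ℂ] V),
        h = D.componentMap (-(k : ℤ)) Γ ↔
          LimitHodge.IsHolomorphic h ∧ (∀ s, h s ∈ D.wp (-(k : ℤ))) ∧ LimitHodge.ext h 0 = 0 ∧
          ∀ s ∈ LimitHodge.puncturedPolydisk n r, ∀ j,
            LimitHodge.pderiv j (LimitHodge.ext h) s =
              -D.component (-(k : ℤ)) (D.form (LimitHodge.ext (D.truncation k Γ)) j s)) ∧
      -- the connection `d + ∂X_{-1}` is flat, with monodromy `e^{-Γ} e^{-N_j} e^{Γ}`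
      D.IsFlat (D.componentMap (-1) Γ) ∧
      ∀ s ∈ LimitHodge.puncturedPolydisk n r, ∀ j, ∀ T : V →L[ℂ] V,
        D.IsMonodromy (D.componentMap (-1) Γ) j s T ↔
          T = NormedSpace.exp (-(LimitHodge.ext Γ s)) * NormedSpace.exp (-(D.N j)) *
            NormedSpace.exp (LimitHodge.ext Γ s) := by
  refine ⟨⟨fun Γ hΓ => hΓ.isHiggsMap, D.injOn_componentMap, fun g hg => hg.exists_isSolution hr⟩,
    fun Γ hΓ => ⟨fun k hk h => hΓ.eq_componentMap_iff hk h, hΓ.isHiggsMap.isFlat,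
      fun s hs j T => hΓ.isMonodromy_iff hs j T⟩⟩
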